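/- Let $(X, R, Y, R^\vee)$ be a reduced root datum, i.e. the root datum $(X^*(T), R, X_*(T), R^\vee)$ of a connected reductive group $G$ split over $L$ with split maximal torus $T$. Let $W$ be its Weyl group, acting on $Y = X_*(T)$, let $Q^\vee \subset Y$ be the coroot lattice, $\tilde W = X_*(T) \rtimes W$ the Iwahori Weyl group (extended affine Weyl group) with translation elements $t_\nu$ ($\nu \in X_*(T)$), and $W_a = Q^\vee \rtimes W \subset \tilde W$ the affine Weyl group. The group $\tilde W$ acts by affine transformations on the apartment $V = X_*(T_{ad}) \otimes \mathbb{R}$ (where $X_*(T_{ad}) = \mathrm{Hom}(\mathbb{Z}R, \mathbb{Z})$), with $t_\nu$ acting as translation by the image $\nu_{ad}$ of $\nu$. Fix any closed alcove $\mathbf{a} \subset V$ for the hyperplanes $\beta = m$ ($\beta \in R$, $m \in \mathbb{Z}$). The reflections in the walls of $\mathbf{a}$ are Coxeter generators of $W_a$ and define a Bruhat order on $W_a$; it is extended to $\tilde W = W_a \rtimes \Omega$, where $\Omega$ is the stabilizer of $\mathbf{a}$, by $w\sigma \le w'\sigma'$ if and only if $\sigma = \sigma'$ and $w \le w'$ ($w,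 w' \in W_a$; $\sigma, \sigma' \in \Omega$). For $\mu \in X_*(T)$ let $\Lambda = W\mu$, let $\mathcal{P}_\mu \subset V$ be the convex hull of $\{\lambda_{ad} : \lambda \in \Lambda\}$, and put $$\mathrm{Adm}(\mu) = \{ w \in \tilde W : w \le t_\lambda \text{ for some } \lambda \in \Lambda \},$$ $$\mathrm{Perm}(\mu) = \{ w \in \tilde W : w \equiv t_\lambda \bmod W_a \text{ for all } \lambda \in \Lambda, \text{ and } w(a) - a \in \mathcal{P}_\mu \text{ for all } a \in \mathbf{a} \}.$$ **Proposition 3.5** (Kottwitz, Haines). The sets $\mathrm{Adm}(\mu)$ and $\mathrm{Perm}(\mu)$ contain the same translation elements: $$X_*(T) \cap \mathrm{Adm}(\mu) = X_*(T) \cap \mathrm{Perm}(\mu).$$ -/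

import Mathlib

open scoped Pointwise

noncomputable section

namespace RootDatum

variable {ι X Y : Type*} [AddCommGroup X] [AddCommGroup Y] (P : RootDatum ι X Y)

/-! A root datum `P : RootDatum ι X Y` is that of a split group `G` with split maximal torus `T`:
`X = X^*(T)`, `Y = X_*(T)`, and `P.root`, `P.coroot` are the roots and coroots. -/

/-- The Weyl group `W`, in its action on the cocharacter lattice `Y` (it is generated by the
reflections `ν ↦ ν - ⟨β, ν⟩ β^∨`). -/
abbrev Weyl : Type _ := RootPairing.weylGroup P.flip

/-- The action of `W` on `Y`, as a homomorphism to the automorphisms of the translation group. -/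
def weylAut : P.Weyl →* MulAut (Multiplicative Y) :=
  (MulAutMultiplicative (G := Y)).symm.toMonoidHom.comp (DistribMulAction.toAddAut P.Weyl Y)

/-- The Iwahori Weyl group (extended affine Weyl group) `X_*(T) ⋊ W`. -/
abbrev IwahoriWeyl : Type _ := Multiplicative Y ⋊[P.weylAut] P.Weyl

/-- The translation element `t_ν`. -/
def trans (ν : Y) : P.IwahoriWeyl := SemidirectProduct.inl (Multiplicative.ofAdd ν)

lemma weylAut_apply (g : P.Weyl) (ν : Multiplicative Y) :
    (P.weylAut g ν).toAdd = g • ν.toAdd := rfl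

lemma smul_mem_corootLattice (g : P.Weyl) {ν : Y} (h : ν ∈ P.corootSpan ℤ) :
    g • ν ∈ P.corootSpan ℤ := by
  induction h using Submodule.span_induction with
  | mem x hx =>
    obtain ⟨i, rfl⟩ := hx
    have := RootPairing.weylGroup_apply_root P.flip g i
    exact Submodule.subset_span ⟨_, this.symm⟩
  | zero => simp
  | add x y _ _ hx hy => rw [smul_add]; exact add_mem hx hy
  | smul a x _ hx => rw [smul_comm]; exact Submodule.smul_mem _ _ hx

/-- The affine Weyl group `W_a = Q^∨ ⋊ W`, where `Q^∨` is the coroot lattice, as a subgroup of the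
Iwahori Weyl group. -/
def affineWeyl : Subgroup P.IwahoriWeyl where
  carrier := {w | w.left.toAdd ∈ P.corootSpan ℤ}
  one_mem' := by simp
  mul_mem' {a b} ha hb := by
    simp only [Set.mem_ofPred_eq, SemidirectProduct.mul_left, toAdd_mul, weylAut_apply] at *
    exact add_mem ha (P.smul_mem_corootLattice _ hb)
  inv_mem' {a} ha := by
    simp only [Set.mem_ofPred_eq, SemidirectProduct.inv_left, weylAut_apply, toAdd_inv] at *
    exact P.smul_mem_corootLattice _ (neg_mem ha)

/-- The apartment `X_*(T_ad) ⊗ ℝ = Hom(Q, ℝ)`, where the root lattice `Q` is the character lattice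
of the adjoint torus; the origin is a hyperspecial vertex. -/
abbrev Apartment : Type _ := P.rootSpan ℤ →ₗ[ℤ] ℝ

/-- The value `β_i(v)` of a root at a point of the apartment. -/
def rootVal (i : ι) (v : P.Apartment) : ℝ := v (P.rootSpanMem ℤ i)

/-- The natural map `X_*(T) → X_*(T_ad) ⊗ ℝ`, `ν ↦ ⟨·, ν⟩`. -/
def toApartment : Y →+ P.Apartment where
  toFun ν := (Algebra.linearMap ℤ ℝ) ∘ₗ (P.toLinearMap.flip ν) ∘ₗ (P.rootSpan ℤ).subtype
  map_zero' := by ext; simp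
  map_add' := by intros; ext; simp

/-- The transpose of the action of `g ∈ W` on `Y`, restricted to the root lattice. -/
def rootLatticeMap (g : P.Weyl) : P.rootSpan ℤ →ₗ[ℤ] P.rootSpan ℤ :=
  (g : P.flip.Aut).toHom.coweightMap.restrict (p := P.rootSpan ℤ) (q := P.rootSpan ℤ) <| by
    intro x hx
    induction hx using Submodule.span_induction with
    | mem x hx =>
      obtain ⟨i, rfl⟩ := hx
      have := RootPairing.Hom.coroot_coweightMap_apply P.flip P.flip i (g : P.flip.Aut).toHom
      exact Submodule.subset_span ⟨_, this.symm⟩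
    | zero => simp
    | add x y _ _ hx hy => rw [map_add]; exact add_mem hx hy
    | smul a x _ hx => rw [map_smul]; exact Submodule.smul_mem _ _ hx

/-- The action of the Iwahori Weyl group on the apartment by affine transformations:
`t_ν g` maps `v` to `g(v) + ν_ad`. -/
instance : MulAction P.IwahoriWeyl P.Apartment where
  smul w v := v ∘ₗ P.rootLatticeMap w.right + P.toApartment w.left.toAdd
  one_smul v := by
    change v ∘ₗ P.rootLatticeMap 1 + P.toApartment 0 = v
    rw [map_zero, add_zero]
    rfl
  mul_smul a b v := by
    change v ∘ₗ P.rootLatticeMap (a.right * b.right) +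
        P.toApartment (a.left.toAdd + a.right • b.left.toAdd) =
      (v ∘ₗ P.rootLatticeMap b.right + P.toApartment b.left.toAdd) ∘ₗ P.rootLatticeMap a.right +
        P.toApartment a.left.toAdd
    have key : P.toApartment (a.right • b.left.toAdd) =
        P.toApartment b.left.toAdd ∘ₗ P.rootLatticeMap a.right := by
      ext x
      have := LinearMap.congr_fun (RootPairing.Hom.weight_coweight_transpose_apply P.flip P.flip
        (x : X) (a.right : P.flip.Aut).toHom) b.left.toAdd
      exact congrArg (Int.cast : ℤ → ℝ) this
    rw [map_add, key, LinearMap.add_comp, add_comm (P.toApartment a.left.toAdd), ← add_assoc]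
    rfl

/-- The reflection `s_{β - m}` in the hyperplane `β = m` of the apartment, i.e. `t_{mβ^∨} s_β`. -/
def affineReflection (i : ι) (m : ℤ) : P.IwahoriWeyl :=
  ⟨Multiplicative.ofAdd (m • P.coroot i), RootPairing.weylGroup.ofIdx P.flip i⟩

/-- A (closed) alcove: for a point `x` on no hyperplane `β = m`, the set of the points `v` of the
apartment which no such hyperplane strictly separates from `x`. -/
def IsAlcove (A : Set P.Apartment) : Prop :=
  ∃ x : P.Apartment, (∀ (i : ι) (m : ℤ), P.rootVal i x ≠ m) ∧
    A = {v | ∀ (i : ι) (m : ℤ), (P.rootVal i x < m → P.rootVal i v ≤ m) ∧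
      ((m : ℝ) < P.rootVal i x → (m : ℝ) ≤ P.rootVal i v)}

/-- The hyperplane `β_i = m` is a wall of the closed alcove `A`: it contains a point of `A` lying on
no other hyperplane. -/
def IsWall (A : Set P.Apartment) (i : ι) (m : ℤ) : Prop :=
  ∃ v ∈ A, P.rootVal i v = m ∧ ∀ (j : ι) (k : ℤ), P.rootVal j v = k →
    {u : P.Apartment | P.rootVal j u = k} = {u : P.Apartment | P.rootVal i u = m}

/-- The Coxeter generators of `W_a` attached to an alcove: the reflections in its walls. -/
def simpleReflections (A : Set P.Apartment) : Set P.IwahoriWeyl :=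
  {s | ∃ (i : ι) (m : ℤ), P.IsWall A i m ∧ s = P.affineReflection i m}

/-- The Coxeter length of `w ∈ W_a`: the least length of a word in the simple reflections with
product `w`. -/
def length (A : Set P.Apartment) (w : P.IwahoriWeyl) : ℕ :=
  sInf {n | ∃ l : List P.IwahoriWeyl,
    (∀ s ∈ l, s ∈ P.simpleReflections A) ∧ l.prod = w ∧ l.length = n}

/-- The Bruhat order on `W_a`: the reflexive and transitive closure of the relation
`x → s x` for a reflection `s` with `ℓ(x) < ℓ(s x)`. -/
def affineBruhatLE (A : Set P.Apartment) : P.affineWeyl → P.affineWeyl → Prop :=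
  Relation.ReflTransGen fun x y => ∃ (i : ι) (m : ℤ),
    (y : P.IwahoriWeyl) = P.affineReflection i m * x ∧ P.length A x < P.length A y

/-- The subgroup `Ω` of the Iwahori Weyl group which preserves the alcove `A` as a set. -/
def Omega (A : Set P.Apartment) : Subgroup P.IwahoriWeyl :=
  MulAction.stabilizer P.IwahoriWeyl A

/-- The Bruhat order on the Iwahori Weyl group `W_a ⋊ Ω`: `w σ ≤ w' σ'` if and only if `σ = σ'` and
`w ≤ w'`. -/
def bruhatLE (A : Set P.Apartment) (x y : P.IwahoriWeyl) : Prop :=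
  ∃ σ ∈ P.Omega A, ∃ w w' : P.affineWeyl,
    x = w * σ ∧ y = w' * σ ∧ P.affineBruhatLE A w w'

/-- The `μ`-admissible set: the elements below some `t_λ` with `λ` in the `W`-orbit of `μ`. -/
def Adm (A : Set P.Apartment) (μ : Y) : Set P.IwahoriWeyl :=
  {w | ∃ lam ∈ MulAction.orbit P.Weyl μ, P.bruhatLE A w (P.trans lam)}

/-- The convex hull in the apartment of the image of the `W`-orbit of `μ`. -/
def orbitHull (μ : Y) : Set P.Apartment :=
  convexHull ℝ (P.toApartment '' MulAction.orbit P.Weyl μ)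

/-- The `μ`-permissible set: the `w` which are congruent to the translations `t_λ`, `λ` in the
`W`-orbit of `μ`, modulo `W_a`, and with `w(a) - a` in the convex hull of that orbit for all `a` in
the alcove. -/
def Perm (A : Set P.Apartment) (μ : Y) : Set P.IwahoriWeyl :=
  {w | (∀ lam ∈ MulAction.orbit P.Weyl μ,
      (QuotientGroup.mk w : P.IwahoriWeyl ⧸ P.affineWeyl) = QuotientGroup.mk (P.trans lam)) ∧
    ∀ a ∈ A, w • a - a ∈ P.orbitHull μ}

end RootDatum

end

/-! The inclusion of the admissible set in the permissible set is convexity. If a Bruhat step goes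
down from `v` to `s * v`, the mirror `β = m` of `s` weakly separates `a` from `v • a` for every `a`
in the base alcove. Hence `s • v • a - a` lies on the segment from `v • a - a` to its image under
the linear reflection of `β`, and the hull is convex and stable under `W`
(`sub_mem_orbitHull_of_affineBruhatLE`). The congruence modulo `W_a` holds because `W` acts
trivially on `Y` modulo the coroot lattice.

Conversely, let `ν_ad` lie in the hull with `μ - ν` in the coroot lattice. For the dominant
representatives `ν⁺`, `μ⁺`, the difference `μ⁺ - ν⁺` lies in the cone of positive coroots, hence is
a sum of simple coroots with coefficients in `ℕ`. A chain of dominant cocharacters, each obtained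
from the previous one by adding a positive coroot, leads from `ν⁺` to `μ⁺`
(`exists_isDominant_add_coroot`). Along each link, `t_{λ - β^∨}` is below `t_λ`, since `⟨β, λ⟩ ≥ 2`
lets two reflections in adjacent parallel hyperplanes both go up (`reflTransGen_trans_sub_coroot`).
That criterion is invariant under `W`, so the chain can be moved back to start at `ν`.

Both directions need the Bruhat order in geometric terms: multiplying `w` on the left by a
reflection shortens it exactly when the mirror separates the base alcove from its image under `w`
(`length_mul_lt`, `lt_length_mul`). This rests on the exchange condition for galleries and on the
generation of `W_a` by the reflections in the walls. -/

noncomputable section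

namespace RootDatum

open Filter Topology
open scoped NNReal

variable {ι X Y : Type*} [AddCommGroup X] [AddCommGroup Y] (P : RootDatum ι X Y)

/-! ### Root values, the action on the apartment, and affine reflections. -/

/-- A root, as a linear form on the apartment. -/
def rootForm (i : ι) : P.Apartment →ₗ[ℝ] ℝ where
  toFun v := P.rootVal i v
  map_add' _ _ := rfl
  map_smul' _ _ := rfl

@[simp] lemma rootForm_apply (i : ι) (v : P.Apartment) : P.rootForm i v = P.rootVal i v := rfl

@[simp] lemma rootVal_add (i : ι) (u v : P.Apartment) :
    P.rootVal i (u + v) = P.rootVal i u + P.rootVal i v := rfl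

@[simp] lemma rootVal_sub (i : ι) (u v : P.Apartment) :
    P.rootVal i (u - v) = P.rootVal i u - P.rootVal i v := rfl

@[simp] lemma rootVal_smul (i : ι) (c : ℝ) (v : P.Apartment) :
    P.rootVal i (c • v) = c * P.rootVal i v := rfl

@[simp] lemma rootVal_zero (i : ι) : P.rootVal i 0 = 0 := rfl

lemma apartment_ext {u v : P.Apartment} (h : ∀ i, P.rootVal i u = P.rootVal i v) : u = v := by
  refine LinearMap.ext fun ⟨x, hx⟩ => ?_
  induction hx using Submodule.span_induction with
  | mem x hx => obtain ⟨i, rfl⟩ := hx; exact h i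
  | zero => exact (map_zero u).trans (map_zero v).symm
  | add x y hx hy h1 h2 =>
    have h := congrArg₂ (· + ·) h1 h2
    exact (map_add u ⟨x, hx⟩ ⟨y, hy⟩).trans (h.trans (map_add v ⟨x, hx⟩ ⟨y, hy⟩).symm)
  | smul a x hx h1 =>
    have h := congrArg (a • ·) h1
    exact (map_smul u a ⟨x, hx⟩).trans (h.trans (map_smul v a ⟨x, hx⟩).symm)

@[simp] lemma rootVal_toApartment (i : ι) (ν : Y) :
    P.rootVal i (P.toApartment ν) = (P.toLinearMap (P.root i) ν : ℝ) := rfl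

/-- The image of a coroot in the apartment. -/
def corootPt (i : ι) : P.Apartment := P.toApartment (P.coroot i)

@[simp] lemma rootVal_corootPt (i j : ι) : P.rootVal i (P.corootPt j) = P.pairing i j := rfl

/-- The permutation of the roots through which an element of the Iwahori Weyl group changes the
values of roots on the apartment. -/
def rootPerm (w : P.IwahoriWeyl) : ι ≃ ι := (w.right : P.flip.Aut).toHom.indexEquiv.symm

lemma rootVal_smul_point (w : P.IwahoriWeyl) (i : ι) (v : P.Apartment) :
    P.rootVal i (w • v) =
      P.rootVal (P.rootPerm w i) v + P.toLinearMap (P.root i) w.left.toAdd := by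
  have h := RootPairing.Hom.coroot_coweightMap_apply P.flip P.flip i (w.right : P.flip.Aut).toHom
  change v (P.rootLatticeMap w.right (P.rootSpanMem ℤ i)) + _ = _
  have h2 : P.rootLatticeMap w.right (P.rootSpanMem ℤ i) = P.rootSpanMem ℤ (P.rootPerm w i) :=
    Subtype.ext h
  rw [h2]
  rfl

lemma weyl_smul_coroot (g : P.Weyl) (i : ι) :
    g • P.coroot i = P.coroot ((g : P.flip.Aut).toHom.indexEquiv i) :=
  RootPairing.Hom.root_weightMap_apply P.flip P.flip i (g : P.flip.Aut).toHom

lemma toLinearMap_weyl_smul (g : P.Weyl) (i : ι) (ν : Y) :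
    P.toLinearMap (P.root i) (g • ν) =
      P.toLinearMap (P.root ((g : P.flip.Aut).toHom.indexEquiv.symm i)) ν := by
  have h : P.toLinearMap ((g : P.flip.Aut).toHom.coweightMap (P.root i)) ν =
      P.toLinearMap (P.root i) (g • ν) :=
    (LinearMap.congr_fun (RootPairing.Hom.weight_coweight_transpose_apply P.flip P.flip
        (P.root i) (g : P.flip.Aut).toHom) ν).symm
  have h2 := RootPairing.Hom.coroot_coweightMap_apply P.flip P.flip i (g : P.flip.Aut).toHom
  have h3 : (g : P.flip.Aut).toHom.coweightMap (P.root i) =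
    P.root ((g : P.flip.Aut).toHom.indexEquiv.symm i) := h2
  rw [← h3, h]

lemma ofIdx_smul (i : ι) (ν : Y) :
    RootPairing.weylGroup.ofIdx P.flip i • ν = ν - P.toLinearMap (P.root i) ν • P.coroot i := by
  change P.flip.reflection i ν = _
  rw [RootPairing.reflection_apply]
  rfl

lemma weyl_ext {g h : P.Weyl} (H : ∀ ν : Y, g • ν = h • ν) : g = h := by
  apply Subtype.ext
  apply RootPairing.Equiv.weightHom_injective
  apply LinearEquiv.ext
  exact H

@[simp] lemma affineReflection_left (i : ι) (m : ℤ) :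
    (P.affineReflection i m).left = Multiplicative.ofAdd (m • P.coroot i) := rfl

@[simp] lemma affineReflection_right (i : ι) (m : ℤ) :
    (P.affineReflection i m).right = RootPairing.weylGroup.ofIdx P.flip i := rfl

lemma toLinearMap_root_coroot (i j : ι) :
    P.toLinearMap (P.root i) (P.coroot j) = P.pairing i j := rfl

/-- Conjugation of an affine reflection by an element of the Iwahori Weyl group. -/
lemma affineReflection_mul (w : P.IwahoriWeyl) (i : ι) (m : ℤ) :
    P.affineReflection i m * w = w * P.affineReflection (P.rootPerm w i)
      (m - P.toLinearMap (P.root i) w.left.toAdd) := by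
  have hc : w.right • P.coroot (P.rootPerm w i) = P.coroot i := by
    rw [weyl_smul_coroot, rootPerm, Equiv.apply_symm_apply]
  refine SemidirectProduct.ext ?_ ?_
  · apply Multiplicative.toAdd.injective
    simp only [SemidirectProduct.mul_left, toAdd_mul, weylAut_apply, affineReflection_left,
      affineReflection_right, toAdd_ofAdd, ofIdx_smul]
    rw [smul_comm, hc, sub_smul]
    abel
  · refine P.weyl_ext fun ν => ?_
    simp only [SemidirectProduct.mul_right, mul_smul, affineReflection_right, ofIdx_smul, smul_sub]
    rw [smul_comm, hc, toLinearMap_weyl_smul]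
    rfl

lemma affineReflection_smul (i : ι) (m : ℤ) (v : P.Apartment) :
    P.affineReflection i m • v = v - (P.rootVal i v - m) • P.corootPt i := by
  refine P.apartment_ext fun j => ?_
  have h : P.rootVal (P.rootPerm (P.affineReflection i m) j) v =
      P.rootVal j v - P.rootVal i v * P.pairing j i := by
    have h1 : P.root (P.rootPerm (P.affineReflection i m) j) =
        P.root j - P.pairing j i • P.root i := by
      have := RootPairing.Hom.coroot_coweightMap_apply P.flip P.flip j
        ((P.affineReflection i m).right : P.flip.Aut).toHom
      refine this.symm.trans ?_
      change P.reflection i (P.root j) = _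
      rw [RootPairing.reflection_apply]
      rfl
    have h2 : P.rootSpanMem ℤ (P.rootPerm (P.affineReflection i m) j) =
        P.rootSpanMem ℤ j - P.pairing j i • P.rootSpanMem ℤ i := Subtype.ext h1
    unfold rootVal
    rw [h2, map_sub, map_smul, zsmul_eq_mul]
    ring
  rw [rootVal_smul_point, h]
  simp [P.toLinearMap_root_coroot]
  ring

lemma affineReflection_mul_self (i : ι) (m : ℤ) :
    P.affineReflection i m * P.affineReflection i m = 1 := by
  have h : ∀ ν : Y, RootPairing.weylGroup.ofIdx P.flip i • RootPairing.weylGroup.ofIdx P.flip i • ν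
      = ν := by
    intro ν
    simp only [ofIdx_smul, map_sub, map_zsmul, P.toLinearMap_root_coroot, RootPairing.pairing_same,
      smul_eq_mul, sub_smul, mul_smul, two_smul, smul_add]
    abel
  refine SemidirectProduct.ext ?_ ?_
  · apply Multiplicative.toAdd.injective
    simp only [SemidirectProduct.mul_left, toAdd_mul, weylAut_apply, affineReflection_left,
      affineReflection_right, toAdd_ofAdd, ofIdx_smul, map_zsmul, P.toLinearMap_root_coroot,
      RootPairing.pairing_same, smul_eq_mul, mul_smul, two_smul, smul_add,
      SemidirectProduct.one_left, toAdd_one]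
    abel
  · refine P.weyl_ext fun ν => ?_
    simp only [SemidirectProduct.mul_right, mul_smul, affineReflection_right, h,
      SemidirectProduct.one_right, one_smul]

@[simp] lemma affineReflection_mul_cancel (i : ι) (m : ℤ) (w : P.IwahoriWeyl) :
    P.affineReflection i m * (P.affineReflection i m * w) = w := by
  rw [← mul_assoc, affineReflection_mul_self, one_mul]

lemma affineReflection_mem (i : ι) (m : ℤ) : P.affineReflection i m ∈ P.affineWeyl :=
  Submodule.smul_mem (P.corootSpan ℤ) m (Submodule.subset_span (Set.mem_range_self i))

lemma trans_smul (ν : Y) (v : P.Apartment) : P.trans ν • v = v + P.toApartment ν := rfl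

/-- The perfect pairing makes `X` reflexive, hence torsion free. -/
lemma isTorsionFree_left {ι X Y : Type*} [AddCommGroup X] [AddCommGroup Y]
    (P : RootDatum ι X Y) : Module.IsTorsionFree ℤ X := by
  have : Module.IsReflexive ℤ X := .of_isPerfPair P.toLinearMap
  infer_instance

lemma ofIdx_eq_of_root_eq_neg {i j : ι} (h : P.root i = -P.root j) (h2 : P.coroot i = -P.coroot j) :
    RootPairing.weylGroup.ofIdx P.flip i = RootPairing.weylGroup.ofIdx P.flip j :=
  P.weyl_ext fun ν => by simp only [ofIdx_smul, h, h2, map_neg, LinearMap.neg_apply,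
    neg_smul, smul_neg, neg_neg]

lemma rootVal_of_root_eq_neg {i j : ι} (h : P.root i = -P.root j) (v : P.Apartment) :
    P.rootVal i v = -P.rootVal j v := by
  have hv : P.rootSpanMem ℤ i = -P.rootSpanMem ℤ j := Subtype.ext h
  unfold rootVal
  rw [hv, map_neg]

/-! ### Hyperplanes and the reflections they determine. -/

section Hyperplanes

variable [Finite ι] [P.IsReduced]

/-- Reducedness enters here: the value 4 would force the two roots to be proportional. -/
lemma pairing_mul_pairing_ne_four {i j : ι} (h : i ≠ j) (h' : P.root i ≠ -P.root j) :
    P.pairing i j * P.pairing j i ≠ 4 := by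
  have := isTorsionFree_left P
  have := RootPairing.coxeterWeightIn_ne_four P ℤ h h'
  simpa [RootPairing.coxeterWeightIn, ← RootPairing.algebraMap_pairingIn P ℤ] using this

/-- The values of two roots which are not proportional can be prescribed. -/
lemma exists_rootVal_eq {i j : ι} (h : i ≠ j) (h' : P.root i ≠ -P.root j) (a b : ℝ) :
    ∃ u, P.rootVal i u = a ∧ P.rootVal j u = b := by
  have h4 : (P.pairing i j * P.pairing j i : ℝ) ≠ 4 := by
    exact_mod_cast P.pairing_mul_pairing_ne_four h h'
  have h5 : (4 - P.pairing i j * P.pairing j i : ℝ) ≠ 0 := fun h => h4 (by linarith)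
  -- Cramer's rule in the span of the two coroots; the determinant is `4 - ⟨β_i, β_j^∨⟩⟨β_j,
  -- β_i^∨⟩`.
  refine ⟨((2 * a - P.pairing i j * b) / (4 - P.pairing i j * P.pairing j i)) • P.corootPt i +
    ((2 * b - P.pairing j i * a) / (4 - P.pairing i j * P.pairing j i)) • P.corootPt j, ?_, ?_⟩
  · simp
    field_simp
    ring
  · simp
    field_simp
    ring

/-- A hyperplane determines its reflection. -/
lemma affineReflection_eq_of_hyperplane_eq {i j : ι} {m k : ℤ}
    (h : {u : P.Apartment | P.rootVal j u = k} = {u : P.Apartment | P.rootVal i u = m}) :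
    P.affineReflection j k = P.affineReflection i m := by
  have := isTorsionFree_left P
  have hu : P.rootVal i (((m : ℝ) / 2) • P.corootPt i) = m := by simp
  have hu' : P.rootVal j (((m : ℝ) / 2) • P.corootPt i) = k := by
    have : ((m : ℝ) / 2) • P.corootPt i ∈ {u : P.Apartment | P.rootVal i u = m} := hu
    rwa [← h] at this
  by_cases hij : i = j
  · subst hij
    have : (m : ℝ) = k := hu.symm.trans hu'
    rw [Int.cast_inj.1 this]
  by_cases hn : P.root i = -P.root j
  · have hj : P.root j = -P.root i := by rw [hn, neg_neg]
    have hcn : P.coroot i = -P.coroot j := by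
      have h1 := (P.root_eq_neg_iff (i := i) (j := j)).1 hn
      rw [h1, RootPairing.coroot_reflectionPerm]
      simp
    have hv : P.rootSpanMem ℤ j = -P.rootSpanMem ℤ i := Subtype.ext hj
    have hk : (k : ℝ) = -m := by
      rw [← hu', ← congrArg Neg.neg hu]
      simp only [rootVal, hv, map_neg]
    have hk' : k = -m := by exact_mod_cast hk
    refine SemidirectProduct.ext ?_ ?_
    · simp [hk', hcn]
    · exact (P.ofIdx_eq_of_root_eq_neg hn hcn).symm
  · obtain ⟨u, h1, h2⟩ := P.exists_rootVal_eq hij hn m (k + 1)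
    have : u ∈ {u : P.Apartment | P.rootVal i u = m} := h1
    rw [← h] at this
    have : P.rootVal j u = k := this
    linarith

end Hyperplanes

/-! ### Alcoves, separating hyperplanes and generic perturbation. -/

/-- A point of the apartment is regular if it lies on no affine root hyperplane. -/
def IsRegular (x : P.Apartment) : Prop := ∀ (i : ι) (m : ℤ), P.rootVal i x ≠ m

/-- The closed alcove of a regular point. -/
def alcoveOf (x : P.Apartment) : Set P.Apartment :=
  {v | ∀ (i : ι) (m : ℤ), (P.rootVal i x < m → P.rootVal i v ≤ m) ∧
      ((m : ℝ) < P.rootVal i x → (m : ℝ) ≤ P.rootVal i v)}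

/-- The hyperplane `β_i = m` strictly separates two points. -/
def Separates (i : ι) (m : ℤ) (x y : P.Apartment) : Prop :=
  (P.rootVal i x < m ∧ m < P.rootVal i y) ∨ (P.rootVal i y < m ∧ m < P.rootVal i x)

/-- The hyperplane `w⁻¹ H` for a hyperplane `H`. -/
def hypPerm (w : P.IwahoriWeyl) (p : ι × ℤ) : ι × ℤ :=
  (P.rootPerm w p.1, p.2 - P.toLinearMap (P.root p.1) w.left.toAdd)

variable {P}

lemma hypPerm_injective (w : P.IwahoriWeyl) : Function.Injective (P.hypPerm w) := by
  rintro ⟨i, m⟩ ⟨j, k⟩ h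
  obtain ⟨h1, h2⟩ := Prod.ext_iff.1 h
  have hij : i = j := (P.rootPerm w).injective h1
  subst hij
  simp only [hypPerm] at h2
  exact Prod.ext rfl (by simpa using h2)

lemma hypPerm_surjective (w : P.IwahoriWeyl) : Function.Surjective (P.hypPerm w) := by
  rintro ⟨i, m⟩
  exact ⟨((P.rootPerm w).symm i, m + P.toLinearMap (P.root ((P.rootPerm w).symm i)) w.left.toAdd),
    by simp [hypPerm]⟩

lemma rootVal_smul_sub (w : P.IwahoriWeyl) (p : ι × ℤ) (v : P.Apartment) :
    P.rootVal p.1 (w • v) - p.2 = P.rootVal (P.hypPerm w p).1 v - (P.hypPerm w p).2 := by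
  rw [rootVal_smul_point]
  simp only [hypPerm, Int.cast_sub]
  ring

lemma affineReflection_mul_hypPerm (w : P.IwahoriWeyl) (p : ι × ℤ) :
    P.affineReflection p.1 p.2 * w =
      w * P.affineReflection (P.hypPerm w p).1 (P.hypPerm w p).2 :=
  P.affineReflection_mul w p.1 p.2

lemma IsRegular.smul {x : P.Apartment} (hx : P.IsRegular x) (w : P.IwahoriWeyl) :
    P.IsRegular (w • x) := fun i m h => by
  have := rootVal_smul_sub w (i, m) x
  rw [h, sub_self] at this
  exact hx _ _ (sub_eq_zero.1 this.symm)

lemma separates_smul (w : P.IwahoriWeyl) (p : ι × ℤ) (x y : P.Apartment) :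
    P.Separates p.1 p.2 (w • x) (w • y) ↔
      P.Separates (P.hypPerm w p).1 (P.hypPerm w p).2 x y := by
  have h1 := rootVal_smul_sub w p x
  have h2 := rootVal_smul_sub w p y
  unfold Separates
  constructor <;> rintro (⟨h3, h4⟩ | ⟨h3, h4⟩)
  · left; constructor <;> linarith
  · right; constructor <;> linarith
  · left; constructor <;> linarith
  · right; constructor <;> linarith

lemma smul_mem_alcoveOf {x v : P.Apartment} (w : P.IwahoriWeyl) (h : v ∈ P.alcoveOf x) :
    w • v ∈ P.alcoveOf (w • x) := fun i m => by
  have h1 := rootVal_smul_sub w (i, m) x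
  have h2 := rootVal_smul_sub w (i, m) v
  have h3 := h (P.hypPerm w (i, m)).1 (P.hypPerm w (i, m)).2
  dsimp only at h1 h2
  exact ⟨fun h4 => by linarith [h3.1 (by linarith)], fun h4 => by linarith [h3.2 (by linarith)]⟩

lemma self_mem_alcoveOf (x : P.Apartment) : x ∈ P.alcoveOf x := fun _ _ => ⟨le_of_lt, le_of_lt⟩

/-- Regular points lie strictly on one side or the other, so arguments about several alcoves become
propositional and end with `tauto`. -/
lemma separates_iff {x y : P.Apartment} (hx : P.IsRegular x) (hy : P.IsRegular y) (i : ι) (m : ℤ) :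
    P.Separates i m x y ↔ ¬(P.rootVal i x < m ↔ P.rootVal i y < m) := by
  have h1 := lt_or_gt_of_ne (hx i m)
  have h2 := lt_or_gt_of_ne (hy i m)
  unfold Separates
  constructor
  · rintro (⟨h3, h4⟩ | ⟨h3, h4⟩) h
    · linarith [h.1 h3]
    · linarith [h.2 h3]
  · intro h
    rcases h1 with h1 | h1 <;> rcases h2 with h2 | h2
    · exact absurd (iff_of_true h1 h2) h
    · exact Or.inl ⟨h1, h2⟩
    · exact Or.inr ⟨h2, h1⟩
    · exact absurd (iff_of_false h1.not_gt h2.not_gt) h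

lemma not_separates_self (i : ι) (m : ℤ) (x : P.Apartment) : ¬P.Separates i m x x := by
  rintro (⟨h, h'⟩ | ⟨h, h'⟩) <;> exact lt_asymm h h'

lemma alcoveOf_eq {x y : P.Apartment} (hx : P.IsRegular x) (hy : P.IsRegular y)
    (h : ∀ i m, ¬P.Separates i m x y) : P.alcoveOf x = P.alcoveOf y := by
  have key : ∀ i (m : ℤ), P.rootVal i x < m ↔ P.rootVal i y < m := fun i m =>
    not_not.1 fun hn => h i m ((separates_iff hx hy i m).2 hn)
  have key' : ∀ i (m : ℤ), (m : ℝ) < P.rootVal i x ↔ (m : ℝ) < P.rootVal i y := fun i m => by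
    rw [← not_le, ← not_le, not_iff_not, le_iff_lt_or_eq, le_iff_lt_or_eq,
      or_iff_left (hx i m), or_iff_left (hy i m), key]
  ext v
  simp only [alcoveOf, key, key']

lemma not_separates_of_mem_alcoveOf {x y : P.Apartment} (h : x ∈ P.alcoveOf y)
    (i : ι) (m : ℤ) : ¬P.Separates i m x y := by
  rintro (⟨h1, h2⟩ | ⟨h1, h2⟩)
  · linarith [(h i m).2 h2]
  · linarith [(h i m).1 h1]

lemma alcoveOf_smul (w : P.IwahoriWeyl) (x : P.Apartment) :
    w • P.alcoveOf x = P.alcoveOf (w • x) := by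
  ext v
  rw [Set.mem_smul_set_iff_inv_smul_mem]
  constructor
  · intro h
    simpa using smul_mem_alcoveOf w h
  · intro h
    simpa using smul_mem_alcoveOf w⁻¹ h

/-- This form mentions only the hyperplane as a set of points, so separation does not depend on
which pair `(i, m)` names it; opposite roots name the same one. -/
lemma separates_iff_exists {x y : P.Apartment} (hx : P.IsRegular x) (hy : P.IsRegular y)
    (i : ι) (m : ℤ) : P.Separates i m x y ↔
      ∃ t : ℝ, 0 ≤ t ∧ t ≤ 1 ∧ x + t • (y - x) ∈ {u | P.rootVal i u = m} := by
  simp only [Set.mem_ofPred_eq, rootVal_add, rootVal_smul, rootVal_sub]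
  constructor
  · intro h
    have hne : P.rootVal i y - P.rootVal i x ≠ 0 := by
      rcases h with ⟨h1, h2⟩ | ⟨h1, h2⟩
      · linarith
      · intro h; linarith
    refine ⟨(m - P.rootVal i x) / (P.rootVal i y - P.rootVal i x), ?_, ?_, by field_simp; ring⟩
    · rcases h with ⟨h1, h2⟩ | ⟨h1, h2⟩
      · exact div_nonneg (by linarith) (by linarith)
      · exact div_nonneg_of_nonpos (by linarith) (by linarith)
    · rcases h with ⟨h1, h2⟩ | ⟨h1, h2⟩
      · rw [div_le_one (by linarith)]; linarith
      · rw [div_le_one_of_neg (by linarith)]; linarith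
  · rintro ⟨t, h0, h1, h⟩
    rw [separates_iff hx hy]
    intro hiff
    by_cases hlt : P.rootVal i x < m
    · have h2 := hiff.1 hlt
      rcases h0.eq_or_lt with rfl | h0
      · linarith
      · nlinarith [mul_pos h0 (sub_pos.2 h2), mul_nonneg (sub_nonneg.2 h1) (sub_pos.2 hlt).le]
    · have h2 := lt_of_le_of_ne (not_lt.1 hlt) (hx i m).symm
      have h3 := lt_of_le_of_ne (not_lt.1 (fun h' => hlt (hiff.2 h'))) (hy i m).symm
      rcases h0.eq_or_lt with rfl | h0
      · linarith
      · nlinarith [mul_pos h0 (sub_pos.2 h3), mul_nonneg (sub_nonneg.2 h1) (sub_pos.2 h2).le]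

lemma separates_congr {x y : P.Apartment} (hx : P.IsRegular x) (hy : P.IsRegular y)
    {i j : ι} {m k : ℤ}
    (h : {u : P.Apartment | P.rootVal j u = k} = {u : P.Apartment | P.rootVal i u = m}) :
    P.Separates j k x y ↔ P.Separates i m x y := by
  rw [separates_iff_exists hx hy, separates_iff_exists hx hy, h]

lemma rootVal_affineReflection_smul (i : ι) (m : ℤ) (x : P.Apartment) :
    P.rootVal i (P.affineReflection i m • x) = 2 * m - P.rootVal i x := by
  rw [affineReflection_smul]
  simp
  ring

lemma separates_affineReflection {x : P.Apartment} (hx : P.IsRegular x) (i : ι) (m : ℤ) :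
    P.Separates i m x (P.affineReflection i m • x) := by
  unfold Separates
  rw [rootVal_affineReflection_smul]
  rcases lt_or_gt_of_ne (hx i m) with h | h
  · left; constructor <;> linarith
  · right; constructor <;> linarith

lemma separates_affineReflection_smul {x y : P.Apartment} (hx : P.IsRegular x) (hy : P.IsRegular y)
    (i : ι) (m : ℤ) :
    P.Separates i m x (P.affineReflection i m • y) ↔ ¬P.Separates i m x y := by
  have h := separates_affineReflection hy i m
  rw [separates_iff hy (hy.smul _)] at h
  rw [separates_iff hx (hy.smul _), separates_iff hx hy]
  tauto

lemma finite_separates [Finite ι] (x y : P.Apartment) :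
    {p : ι × ℤ | P.Separates p.1 p.2 x y}.Finite := by
  refine Set.Finite.subset (Set.finite_iUnion fun i : ι =>
    ((Set.finite_Icc (min ⌊P.rootVal i x⌋ ⌊P.rootVal i y⌋)
      (max ⌈P.rootVal i x⌉ ⌈P.rootVal i y⌉)).image (Prod.mk i))) ?_
  rintro ⟨i, m⟩ h
  refine Set.mem_iUnion.2 ⟨i, m, ?_, rfl⟩
  have aux : ∀ {a b : ℝ}, a < m → m < b → ⌊a⌋ ≤ m ∧ m ≤ ⌈b⌉ := fun {a b} h1 h2 =>
    ⟨by exact_mod_cast (Int.floor_le a).trans h1.le, by exact_mod_cast h2.le.trans (Int.le_ceil b)⟩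
  rcases h with ⟨h1, h2⟩ | ⟨h1, h2⟩
  · exact ⟨(min_le_left _ _).trans (aux h1 h2).1, (aux h1 h2).2.trans (le_max_right _ _)⟩
  · exact ⟨(min_le_right _ _).trans (aux h1 h2).1, (aux h1 h2).2.trans (le_max_left _ _)⟩

/-- A small displacement leaves `v` only across hyperplanes through `v` itself, and these do not
exclude `v` from the closed alcove. -/
lemma eventually_mem_alcoveOf [Finite ι] (v d : P.Apartment) :
    ∀ᶠ ε : ℝ in 𝓝 0, v ∈ P.alcoveOf (v + ε • d) := by
  have : ∀ i, ∀ᶠ ε : ℝ in 𝓝 0, (⌈P.rootVal i v⌉ - 1 : ℝ) < P.rootVal i v + ε * P.rootVal i d ∧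
      P.rootVal i v + ε * P.rootVal i d < ⌊P.rootVal i v⌋ + 1 := by
    intro i
    have hc : Tendsto (fun ε : ℝ => P.rootVal i v + ε * P.rootVal i d) (𝓝 0)
        (𝓝 (P.rootVal i v)) := by
      have : Continuous fun ε : ℝ => P.rootVal i v + ε * P.rootVal i d := by fun_prop
      simpa using this.tendsto 0
    exact (hc.eventually_const_lt (by linarith [Int.ceil_lt_add_one (P.rootVal i v)])).and
      (hc.eventually_lt_const (Int.lt_floor_add_one _))
  filter_upwards [eventually_all.2 this] with ε h i m
  obtain ⟨h1, h2⟩ := h i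
  simp only [rootVal_add, rootVal_smul]
  constructor
  · intro h3
    by_contra! h4
    have : m + 1 ≤ ⌈P.rootVal i v⌉ := Int.lt_ceil.2 h4
    have : (m + 1 : ℝ) ≤ ⌈P.rootVal i v⌉ := by exact_mod_cast this
    linarith
  · intro h3
    by_contra! h4
    have : ⌊P.rootVal i v⌋ < m := Int.floor_lt.2 h4
    have : (⌊P.rootVal i v⌋ + 1 : ℝ) ≤ m := by exact_mod_cast this
    linarith

/-- The only integer that can be met near `a` is `a` itself, and either hypothesis rules it out for
`ε ≠ 0`. -/
lemma eventually_ne_int {a b : ℝ} (h : (∀ m : ℤ, a ≠ m) ∨ b ≠ 0) :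
    ∀ᶠ ε : ℝ in 𝓝[≠] 0, ∀ m : ℤ, a + ε * b ≠ m := by
  have hc : Tendsto (fun ε : ℝ => a + ε * b) (𝓝[≠] 0) (𝓝 a) := by
    have : Continuous fun ε : ℝ => a + ε * b := by fun_prop
    simpa using (this.tendsto 0).mono_left nhdsWithin_le_nhds
  filter_upwards [hc.eventually_const_lt (show (⌈a⌉ - 1 : ℝ) < a by
    linarith [Int.ceil_lt_add_one a]), hc.eventually_lt_const (Int.lt_floor_add_one a),
    self_mem_nhdsWithin] with ε h1 h2 h3 m hm
  rw [hm] at h1 h2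
  have h4 : ⌈a⌉ ≤ m := by
    have : ⌈a⌉ - 1 < m := by exact_mod_cast h1
    omega
  have h5 : m ≤ ⌊a⌋ := by
    have : m < ⌊a⌋ + 1 := by exact_mod_cast h2
    omega
  have h6 : a = m := le_antisymm (Int.ceil_le.1 h4) (Int.le_floor.1 h5)
  rcases h with h | h
  · exact h m h6
  · rw [← h6] at hm
    exact mul_ne_zero h3 h (by linarith)

lemma eventually_isRegular [Finite ι] {v d : P.Apartment}
    (h : ∀ i, (∀ m : ℤ, P.rootVal i v ≠ m) ∨ P.rootVal i d ≠ 0) :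
    ∀ᶠ ε : ℝ in 𝓝[≠] 0, P.IsRegular (v + ε • d) :=
  eventually_all.2 fun i => eventually_ne_int (h i)

/-! ### Walls, and transitivity of the group they generate. -/

/-- If an affine root hyperplane separates two regular points, then so does a wall of the alcove
of the first one. -/
lemma exists_isWall_separates [Finite ι] {x y : P.Apartment} (hx : P.IsRegular x)
    (hy : P.IsRegular y) (hne : ∃ i m, P.Separates i m x y) :
    ∃ i m, P.IsWall (P.alcoveOf x) i m ∧ P.Separates i m x y := by
  set F := {p : ι × ℤ | P.Separates p.1 p.2 x y} with hF
  have hFfin : F.Finite := finite_separates x y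
  let a : ι × ℤ → ℝ := fun p => p.2 - P.rootVal p.1 y
  have ha : ∀ p, a p ≠ 0 := fun p h => hy p.1 p.2 (by simp only [a] at h; linarith)
  -- The segment from `z` to `y` can meet two hyperplanes at the same time only if `Λ` vanishes at
  -- `z - y`. If `Λ` is identically zero, the two hyperplanes coincide. So `x` is moved to a nearby
  -- `z` avoiding the zeros of all nonzero `Λ`.
  let Λ : (ι × ℤ) × (ι × ℤ) → Module.Dual ℝ P.Apartment := fun q =>
    a q.1 • P.rootForm q.2.1 - a q.2 • P.rootForm q.1.1
  let T : Set ((ι × ℤ) × (ι × ℤ)) := (F ×ˢ F) ∩ {q | Λ q ≠ 0}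
  have hT : T.Finite := (hFfin.prod hFfin).subset Set.inter_subset_left
  have : Finite T := hT
  obtain ⟨d, hd⟩ := Module.Dual.exists_forall_ne_zero_of_forall_exists (K := ℝ)
    (fun q : T => Λ q) (fun q => by
      by_contra! h
      exact q.2.2 (LinearMap.ext h))
  have e1 : ∀ᶠ ε : ℝ in 𝓝[≠] 0, x ∈ P.alcoveOf (x + ε • d) :=
    (eventually_mem_alcoveOf x d).filter_mono nhdsWithin_le_nhds
  have e2 : ∀ᶠ ε : ℝ in 𝓝[≠] 0, P.IsRegular (x + ε • d) :=
    eventually_isRegular fun i => Or.inl (hx i)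
  have e3 : ∀ᶠ ε : ℝ in 𝓝[≠] 0, ∀ q : T, Λ q (x + ε • d - y) ≠ 0 := by
    refine eventually_all.2 fun q => ?_
    have := eventually_ne_int (a := Λ q (x - y)) (b := Λ q d) (Or.inr (hd q))
    filter_upwards [this] with ε h
    have h0 := h 0
    rwa [Int.cast_zero, ← smul_eq_mul, ← map_smul, ← map_add,
      show x - y + ε • d = x + ε • d - y by abel] at h0
  obtain ⟨ε, h1, h2, h3⟩ := (e1.and (e2.and e3)).exists
  set z := x + ε • d with hz
  have hns := not_separates_of_mem_alcoveOf h1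
  have hsep : ∀ i m, P.Separates i m z y ↔ P.Separates i m x y := fun i m => by
    have := hns i m
    rw [separates_iff hx h2] at this
    rw [separates_iff h2 hy, separates_iff hx hy]
    tauto
  have hal : P.alcoveOf x = P.alcoveOf z := alcoveOf_eq hx h2 hns
  let t : ι × ℤ → ℝ := fun p =>
    (p.2 - P.rootVal p.1 z) / (P.rootVal p.1 y - P.rootVal p.1 z)
  obtain ⟨i0, m0, h0⟩ := hne
  -- The first hyperplane crossed: the crossing point is still in the closed alcove and, by
  -- genericity, on no other hyperplane.
  obtain ⟨p, hpF, hpmin⟩ := Set.exists_min_image F t hFfin ⟨(i0, m0), h0⟩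
  have hpz : P.Separates p.1 p.2 z y := (hsep _ _).2 hpF
  have htp : 0 < t p ∧ t p < 1 := by
    simp only [t]
    rcases hpz with ⟨h4, h5⟩ | ⟨h4, h5⟩
    · exact ⟨div_pos (by linarith) (by linarith), by rw [div_lt_one (by linarith)]; linarith⟩
    · exact ⟨div_pos_of_neg_of_neg (by linarith) (by linarith),
        by rw [div_lt_one_of_neg (by linarith)]; linarith⟩
  have hpne : P.rootVal p.1 y - P.rootVal p.1 z ≠ 0 := by
    rcases hpz with ⟨h4, h5⟩ | ⟨h4, h5⟩
    · linarith
    · intro h; linarith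
  have hval : ∀ j, P.rootVal j (z + t p • (y - z)) =
      P.rootVal j z + t p * (P.rootVal j y - P.rootVal j z) := fun j => by simp
  refine ⟨p.1, p.2, ⟨z + t p • (y - z), ?_, ?_, ?_⟩, hpF⟩
  · rw [hal]
    intro j k
    rw [hval]
    constructor
    · intro h4
      by_contra! h5
      have h6 : 0 < P.rootVal j y - P.rootVal j z := by
        by_contra! h7
        nlinarith
      have h7 : (j, k) ∈ F := (hsep j k).1 (Or.inl ⟨h4, by nlinarith⟩)
      have h8 := hpmin _ h7
      have h9 : t (j, k) < t p := by
        simp only [t] at h5 ⊢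
        rw [div_lt_iff₀ h6]
        linarith
      linarith
    · intro h4
      by_contra! h5
      have h6 : P.rootVal j y - P.rootVal j z < 0 := by
        by_contra! h7
        nlinarith
      have h7 : (j, k) ∈ F := (hsep j k).1 (Or.inr ⟨by nlinarith, h4⟩)
      have h8 := hpmin _ h7
      have h9 : t (j, k) < t p := by
        simp only [t] at h5 ⊢
        rw [div_lt_iff_of_neg h6]
        linarith
      linarith
  · rw [hval]
    simp only [t]
    field_simp
    ring
  · intro j k hjk
    rw [hval] at hjk
    have hjF : (j, k) ∈ F := by
      refine (hsep j k).1 ?_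
      rcases lt_or_gt_of_ne (h2 j k) with h4 | h4
      · left
        refine ⟨h4, ?_⟩
        have h6 : 0 < P.rootVal j y - P.rootVal j z := by
          by_contra! h7
          nlinarith
        nlinarith
      · right
        refine ⟨?_, h4⟩
        have h6 : P.rootVal j y - P.rootVal j z < 0 := by
          by_contra! h7
          nlinarith
        nlinarith
    have hL : Λ (p, (j, k)) = 0 := by
      by_contra hL
      refine h3 ⟨(p, (j, k)), ⟨⟨hpF, hjF⟩, hL⟩⟩ ?_
      have h5 : (p.2 : ℝ) = P.rootVal p.1 z + t p * (P.rootVal p.1 y - P.rootVal p.1 z) := by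
        simp only [t]
        field_simp
        ring
      simp only [Λ, a, LinearMap.sub_apply, LinearMap.smul_apply, rootForm_apply, rootVal_sub,
        smul_eq_mul]
      rw [← hjk, h5]
      ring
    ext u
    have h5 := LinearMap.congr_fun hL (u - y)
    simp only [Λ, LinearMap.sub_apply, LinearMap.smul_apply, rootForm_apply, rootVal_sub,
        smul_eq_mul, LinearMap.zero_apply] at h5
    have hap := ha p
    have haj := ha (j, k)
    simp only [a] at h5 hap haj
    simp only [Set.mem_ofPred_eq]
    constructor
    · intro h6
      rw [h6] at h5
      have : (k - P.rootVal j y) * (p.2 - P.rootVal p.1 u) = 0 := by linarith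
      linarith [(mul_eq_zero.1 this).resolve_left haj]
    · intro h6
      rw [h6] at h5
      have : (p.2 - P.rootVal p.1 y) * (P.rootVal j u - k) = 0 := by linarith
      linarith [(mul_eq_zero.1 this).resolve_left hap]

/-- Only the wall itself separates an alcove from its mirror image in a wall. -/
lemma hyperplane_eq_of_isWall {x : P.Apartment} {i j : ι} {m k : ℤ}
    (hw : P.IsWall (P.alcoveOf x) i m) (h : P.Separates j k x (P.affineReflection i m • x)) :
    {u : P.Apartment | P.rootVal j u = k} = {u : P.Apartment | P.rootVal i u = m} := by
  obtain ⟨v, hv, hvm, huniq⟩ := hw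
  -- The wall point is fixed, so it lies in both closed alcoves, and every hyperplane separating
  -- them passes through it.
  have hfix : P.affineReflection i m • v = v := by
    rw [affineReflection_smul, hvm, sub_self, zero_smul, sub_zero]
  have hv' := smul_mem_alcoveOf (P.affineReflection i m) hv
  rw [hfix] at hv'
  refine huniq j k ?_
  rcases h with ⟨h1, h2⟩ | ⟨h1, h2⟩
  · exact le_antisymm ((hv j k).1 h1) ((hv' j k).2 h2)
  · exact le_antisymm ((hv' j k).1 h1) ((hv j k).2 h2)

lemma mul_self_of_mem_simpleReflections {A : Set P.Apartment} {s : P.IwahoriWeyl}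
    (h : s ∈ P.simpleReflections A) : s * s = 1 := by
  obtain ⟨i, m, -, rfl⟩ := h
  exact P.affineReflection_mul_self i m

lemma ncard_separates_smul_le [Finite ι] (w : P.IwahoriWeyl) (x y : P.Apartment) :
    {p : ι × ℤ | P.Separates p.1 p.2 (w • x) (w • y)}.ncard ≤
      {p : ι × ℤ | P.Separates p.1 p.2 x y}.ncard :=
  Set.ncard_le_ncard_of_injOn (P.hypPerm w) (fun p hp => (separates_smul w p x y).1 hp)
    (hypPerm_injective w).injOn (finite_separates x y)

/-- The group generated by the reflections in the walls of an alcove is transitive on alcoves. -/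
lemma exists_mem_closure_not_separates [Finite ι] {x y : P.Apartment} (hx : P.IsRegular x)
    (hy : P.IsRegular y) :
    ∃ w ∈ Subgroup.closure (P.simpleReflections (P.alcoveOf x)),
      ∀ i m, ¬P.Separates i m x (w • y) := by
  induction hn : {p : ι × ℤ | P.Separates p.1 p.2 x y}.ncard using Nat.strong_induction_on
    generalizing y with
  | _ n ih =>
    by_cases hne : ∃ i m, P.Separates i m x y
    · obtain ⟨i, m, hw, hsep⟩ := exists_isWall_separates hx hy hne
      set s := P.affineReflection i m with hs
      have hlt : {p : ι × ℤ | P.Separates p.1 p.2 x (s • y)}.ncard < n := by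
        have h1 := ncard_separates_smul_le s (s • x) y
        rw [← mul_smul, affineReflection_mul_self, one_smul] at h1
        -- After reflecting by `s`, one counts the hyperplanes between `s • x` and `y`: they all
        -- separate `x` from `y`, and the wall is no longer among them.
        refine h1.trans_lt (hn ▸ Set.ncard_lt_ncard ⟨?_, ?_⟩ (finite_separates x y))
        · intro p hp
          change P.Separates p.1 p.2 x y
          by_contra hnp
          have hxs : P.Separates p.1 p.2 x (s • x) := by
            rw [separates_iff hx (hx.smul _)]
            rw [separates_iff hx hy] at hnp
            have hp' := (separates_iff (hx.smul s) hy p.1 p.2).1 hp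
            tauto
          exact hnp ((separates_congr hx hy (hyperplane_eq_of_isWall hw hxs)).2 hsep)
        · intro hsub
          have h2 : P.Separates i m (s • x) y :=
            hsub (show (i, m) ∈ {p : ι × ℤ | P.Separates p.1 p.2 x y} from hsep)
          have h3 := separates_affineReflection hx i m
          rw [separates_iff (hx.smul _) hy] at h2
          rw [separates_iff hx (hx.smul _)] at h3
          rw [separates_iff hx hy] at hsep
          tauto
      obtain ⟨w, hw', h⟩ := ih _ hlt (hy.smul s) rfl
      exact ⟨w * s, mul_mem hw' (Subgroup.subset_closure ⟨i, m, hw, rfl⟩), by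
        simpa only [mul_smul] using h⟩
    · push Not at hne
      exact ⟨1, one_mem _, by simpa using hne⟩

/-- The reflections with `m = 0` generate `W`, and multiplying the one with `m = 1` by the inverse
of the one with `m = 0` gives translation by the coroot. -/
lemma affineWeyl_le {H : Subgroup P.IwahoriWeyl} (h : ∀ i m, P.affineReflection i m ∈ H) :
    P.affineWeyl ≤ H := by
  have hr : ∀ g : P.Weyl, (SemidirectProduct.inr g : P.IwahoriWeyl) ∈ H := by
    rintro ⟨g, hg⟩
    induction hg using RootPairing.weylGroup.induction with
    | mem i =>
      have h0 := h i 0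
      have : P.affineReflection i 0 =
          SemidirectProduct.inr (RootPairing.weylGroup.ofIdx P.flip i) :=
        SemidirectProduct.ext (by simp) rfl
      rwa [this] at h0
    | one => exact one_mem H
    | mul x y hx hy h1 h2 =>
      have := mul_mem h1 h2
      rwa [← map_mul] at this
  have ht : ∀ ν ∈ P.corootSpan ℤ, P.trans ν ∈ H := by
    intro ν hν
    induction hν using Submodule.span_induction with
    | mem x hx =>
      obtain ⟨i, rfl⟩ := hx
      have : P.trans (P.coroot i) = P.affineReflection i 1 *
          SemidirectProduct.inr (RootPairing.weylGroup.ofIdx P.flip i)⁻¹ :=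
        SemidirectProduct.ext (by simp [trans]) (by simp [trans])
      rw [this]
      exact mul_mem (h i 1) (hr _)
    | zero => exact one_mem H
    | add x y _ _ h1 h2 =>
      have := mul_mem h1 h2
      rwa [trans, trans, ← map_mul, ← ofAdd_add] at this
    | smul a x _ h1 =>
      have := zpow_mem h1 a
      rwa [trans, ← map_zpow, ← ofAdd_zsmul] at this
  intro w hw
  rw [← SemidirectProduct.inl_left_mul_inr_right w]
  exact mul_mem (ht _ hw) (hr _)

lemma length_le {A : Set P.Apartment} {l : List P.IwahoriWeyl}
    (hl : ∀ s ∈ l, s ∈ P.simpleReflections A) : P.length A l.prod ≤ l.length :=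
  Nat.sInf_le ⟨l, hl, rfl, rfl⟩

/-! ### The exchange condition and Coxeter length. -/

section CoxeterGroup

variable [Finite ι] [P.IsReduced]

/-- The exchange condition. -/
lemma exchange {x : P.Apartment} (hx : P.IsRegular x) {l : List P.IwahoriWeyl}
    (hl : ∀ s ∈ l, s ∈ P.simpleReflections (P.alcoveOf x)) {i : ι} {m : ℤ}
    (h : P.Separates i m x (l.prod • x)) :
    ∃ l' : List P.IwahoriWeyl, (∀ s ∈ l', s ∈ P.simpleReflections (P.alcoveOf x)) ∧
      l'.prod = P.affineReflection i m * l.prod ∧ l'.length + 1 = l.length := by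
  induction l generalizing i m with
  | nil => simp [not_separates_self] at h
  | cons s l ih =>
    obtain ⟨j, k, hw, hs⟩ := hl s (by simp)
    -- If the hyperplane is crossed at the first step of the gallery, it is the wall of `s` and that
    -- letter is deleted. Otherwise it is crossed later, and conjugation by `s` reduces to the
    -- shorter word.
    by_cases h1 : P.Separates i m x (s • x)
    · rw [hs] at h1
      have h2 := P.affineReflection_eq_of_hyperplane_eq (hyperplane_eq_of_isWall hw h1)
      refine ⟨l, fun t ht => hl t (by simp [ht]), ?_, by simp⟩
      rw [List.prod_cons, h2, hs, affineReflection_mul_cancel]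
    · have h2 : P.Separates i m (s • x) (s • l.prod • x) := by
        rw [List.prod_cons, mul_smul] at h
        rw [separates_iff hx ((hx.smul _).smul _)] at h
        rw [separates_iff hx (hx.smul _)] at h1
        rw [separates_iff (hx.smul _) ((hx.smul _).smul _)]
        tauto
      obtain ⟨l', hl', hp, hlen⟩ := ih (fun t ht => hl t (by simp [ht]))
        ((separates_smul s (i, m) x (l.prod • x)).1 h2)
      refine ⟨s :: l', ?_, ?_, by simp [hlen]⟩
      · intro t ht
        rcases List.mem_cons.1 ht with rfl | ht
        · exact hl t (by simp)
        · exact hl' t ht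
      · rw [List.prod_cons, hp, List.prod_cons, ← mul_assoc, ← mul_assoc,
          ← affineReflection_mul_hypPerm s (i, m)]

/-- Every affine root hyperplane contains a point lying on no other one. -/
lemma exists_forall_hyperplane_eq (i : ι) (m : ℤ) :
    ∃ v : P.Apartment, P.rootVal i v = m ∧ ∀ (j : ι) (k : ℤ), P.rootVal j v = k →
      {u : P.Apartment | P.rootVal j u = k} = {u : P.Apartment | P.rootVal i u = m} := by
  let T : Set ι := {j | i ≠ j ∧ P.root i ≠ -P.root j}
  have hT : ∀ j : T, ∃ u, (P.rootForm j - ((P.pairing j i : ℝ) / 2) • P.rootForm i) u ≠ 0 := by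
    rintro ⟨j, h1, h2⟩
    obtain ⟨u, hu1, hu2⟩ := P.exists_rootVal_eq h1 h2 0 1
    exact ⟨u, by simp [hu1, hu2]⟩
  obtain ⟨d, hd⟩ := Module.Dual.exists_forall_ne_zero_of_forall_exists (K := ℝ) _ hT
  -- A base point on the hyperplane, moved along the projection of the generic vector `d` to the
  -- kernel of `β_i`; the forms in `hT` are the `β_j` composed with this projection.
  let v : ℝ → P.Apartment := fun ε =>
    ((m : ℝ) / 2) • P.corootPt i + ε • (d - (P.rootVal i d / 2) • P.corootPt i)
  have hv : ∀ j ε, P.rootVal j (v ε) = (m : ℝ) / 2 * P.pairing j i +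
      ε * (P.rootVal j d - P.rootVal i d / 2 * P.pairing j i) := fun j ε => by simp [v]
  have hi : ∀ ε, P.rootVal i (v ε) = m := fun ε => by rw [hv]; simp
  have key : ∀ᶠ ε : ℝ in 𝓝[≠] 0, ∀ j : T, ∀ k : ℤ, P.rootVal j (v ε) ≠ k := by
    refine eventually_all.2 fun j => ?_
    simp only [hv]
    refine eventually_ne_int (Or.inr ?_)
    have := hd j
    simp only [LinearMap.sub_apply, LinearMap.smul_apply, rootForm_apply, smul_eq_mul] at this
    intro h
    apply this
    linarith
  obtain ⟨ε, hε⟩ := key.exists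
  refine ⟨v ε, hi ε, fun j k hjk => ?_⟩
  by_cases h1 : i = j
  · subst h1
    rw [hi] at hjk
    rw [hjk]
  by_cases h2 : P.root i = -P.root j
  · have h3 := P.rootVal_of_root_eq_neg h2
    have h4 : (k : ℝ) = -m := by rw [← hjk, ← hi ε, h3, neg_neg]
    ext u
    simp only [Set.mem_ofPred_eq, h3, h4]
    exact neg_eq_iff_eq_neg.symm
  · exact absurd hjk (hε ⟨j, h1, h2⟩ k)

/-- Every reflection is conjugate to a simple one: an alcove touching the hyperplane at a generic
point is carried to the base alcove by the group of simple reflections, and the hyperplane becomes a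
wall. -/
lemma affineReflection_mem_closure {x : P.Apartment} (hx : P.IsRegular x) (i : ι) (m : ℤ) :
    P.affineReflection i m ∈ Subgroup.closure (P.simpleReflections (P.alcoveOf x)) := by
  obtain ⟨v, hvm, huniq⟩ := exists_forall_hyperplane_eq (P := P) i m
  -- Moving by `β_i^∨` changes `β_i` by 2, so a root integral at `v` cannot vanish on `β_i^∨`: its
  -- hyperplane through `v` is that of `β_i`.
  have hreg : ∀ j, (∀ k : ℤ, P.rootVal j v ≠ k) ∨ P.rootVal j (P.corootPt i) ≠ 0 := by
    intro j
    by_contra! h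
    obtain ⟨⟨k, hk⟩, h0⟩ := h
    have h1 : v + P.corootPt i ∈ {u : P.Apartment | P.rootVal j u = k} := by
      simp only [Set.mem_ofPred_eq, rootVal_add, hk, h0, add_zero]
    rw [huniq j k hk] at h1
    simp only [Set.mem_ofPred_eq, rootVal_add, hvm, rootVal_corootPt,
      RootPairing.pairing_same] at h1
    norm_num at h1
  obtain ⟨ε, h1, h2⟩ := ((eventually_isRegular hreg).and
    ((eventually_mem_alcoveOf v (P.corootPt i)).filter_mono nhdsWithin_le_nhds)).exists
  obtain ⟨w, hw, hsep⟩ := exists_mem_closure_not_separates hx h1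
  obtain ⟨⟨j, n⟩, hjn⟩ := hypPerm_surjective w (i, m)
  have hval : ∀ u, P.rootVal j (w • u) = n ↔ P.rootVal i u = m := fun u => by
    have := rootVal_smul_sub w (j, n) u
    rw [hjn] at this
    dsimp only at this
    constructor <;> intro <;> linarith
  have hwall : P.IsWall (P.alcoveOf x) j n := by
    refine ⟨w • v, ?_, (hval v).2 hvm, ?_⟩
    · rw [alcoveOf_eq hx (h1.smul w) hsep]
      exact smul_mem_alcoveOf w h2
    · intro j' k' h
      have hval' : ∀ u, P.rootVal j' (w • u) = k' ↔
          P.rootVal (P.hypPerm w (j', k')).1 u = (P.hypPerm w (j', k')).2 := fun u => by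
        have := rootVal_smul_sub w (j', k') u
        dsimp only at this
        constructor <;> intro <;> linarith
      have h3 := huniq _ _ ((hval' v).1 h)
      ext u
      have h4 := Set.ext_iff.1 h3 (w⁻¹ • u)
      simp only [Set.mem_ofPred_eq] at h4 ⊢
      rw [← hval', ← hval, smul_inv_smul] at h4
      exact h4
  have hconj := affineReflection_mul_hypPerm w (j, n)
  rw [hjn] at hconj
  dsimp only at hconj
  rw [eq_inv_mul_iff_mul_eq.2 hconj.symm]
  exact mul_mem (inv_mem hw) (mul_mem (Subgroup.subset_closure ⟨j, n, hwall, rfl⟩) hw)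

/-- Simple reflections are involutions, so words need no inverses. Thus on `W_a` the infimum
defining `length` is attained and is not the default value 0 of an empty infimum. -/
lemma exists_word {x : P.Apartment} (hx : P.IsRegular x) {w : P.IwahoriWeyl}
    (hw : w ∈ P.affineWeyl) :
    ∃ l : List P.IwahoriWeyl, (∀ s ∈ l, s ∈ P.simpleReflections (P.alcoveOf x)) ∧ l.prod = w := by
  have hw' := affineWeyl_le (affineReflection_mem_closure hx) hw
  clear hw
  induction hw' using Subgroup.closure_induction with
  | mem s hs => exact ⟨[s], by simpa using hs, by simp⟩
  | one => exact ⟨[], by simp, rfl⟩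
  | mul a b ha hb h1 h2 =>
    obtain ⟨l1, h3, h4⟩ := h1
    obtain ⟨l2, h5, h6⟩ := h2
    exact ⟨l1 ++ l2, by simp only [List.mem_append]; rintro s (h | h) <;> tauto, by simp [h4, h6]⟩
  | inv a _ h =>
    obtain ⟨l, h1, h2⟩ := h
    refine ⟨(l.map (·⁻¹)).reverse, ?_, by rw [← List.prod_inv_reverse, h2]⟩
    intro s hs
    simp only [List.mem_reverse, List.mem_map] at hs
    obtain ⟨t, ht, rfl⟩ := hs
    rw [inv_eq_of_mul_eq_one_left (mul_self_of_mem_simpleReflections (h1 t ht))]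
    exact h1 t ht

lemma exists_reduced_word {x : P.Apartment} (hx : P.IsRegular x) {w : P.IwahoriWeyl}
    (hw : w ∈ P.affineWeyl) :
    ∃ l : List P.IwahoriWeyl, (∀ s ∈ l, s ∈ P.simpleReflections (P.alcoveOf x)) ∧ l.prod = w ∧
      l.length = P.length (P.alcoveOf x) w := by
  obtain ⟨l, h1, h2⟩ := exists_word hx hw
  exact Nat.sInf_mem (s := {n | ∃ l : List P.IwahoriWeyl,
    (∀ s ∈ l, s ∈ P.simpleReflections (P.alcoveOf x)) ∧ l.prod = w ∧ l.length = n})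
    ⟨_, l, h1, h2, rfl⟩

lemma length_mul_lt {x : P.Apartment} (hx : P.IsRegular x) {w : P.IwahoriWeyl}
    (hw : w ∈ P.affineWeyl) {i : ι} {m : ℤ} (h : P.Separates i m x (w • x)) :
    P.length (P.alcoveOf x) (P.affineReflection i m * w) < P.length (P.alcoveOf x) w := by
  obtain ⟨l, h1, rfl, h3⟩ := exists_reduced_word hx hw
  obtain ⟨l', h4, h5, h6⟩ := exchange hx h1 h
  rw [← h5, ← h3]
  have := length_le h4
  omega

lemma lt_length_mul {x : P.Apartment} (hx : P.IsRegular x) {w : P.IwahoriWeyl}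
    (hw : w ∈ P.affineWeyl) {i : ι} {m : ℤ} (h : ¬P.Separates i m x (w • x)) :
    P.length (P.alcoveOf x) w < P.length (P.alcoveOf x) (P.affineReflection i m * w) := by
  have := length_mul_lt hx (mul_mem (P.affineReflection_mem i m) hw) (i := i) (m := m) (by
    rw [mul_smul, separates_affineReflection_smul hx (hx.smul _)]
    exact h)
  rwa [affineReflection_mul_cancel] at this

/-- The affine Weyl group acts freely on the alcoves. -/
lemma eq_one_of_forall_not_separates {x : P.Apartment} (hx : P.IsRegular x) {w : P.IwahoriWeyl}
    (hw : w ∈ P.affineWeyl) (h : ∀ i m, ¬P.Separates i m x (w • x)) : w = 1 := by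
  obtain ⟨l, h1, rfl, h3⟩ := exists_reduced_word hx hw
  cases l with
  | nil => rfl
  | cons s l =>
    exfalso
    obtain ⟨i, m, -, hs⟩ := h1 s (by simp)
    -- No mirror separates, so every reflection lengthens; but the first letter of a reduced word
    -- shortens.
    have h4 := lt_length_mul hx hw (h i m)
    rw [List.prod_cons, hs, affineReflection_mul_cancel] at h4
    rw [List.prod_cons, hs, List.length_cons] at h3
    have := length_le (l := l) (fun t ht => h1 t (by simp [ht]))
    omega

end CoxeterGroup

/-! ### The stabilizer of the alcove and the Weyl-stability of the hull. -/

lemma simpleReflections_subset (A : Set P.Apartment) :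
    P.simpleReflections A ⊆ P.affineWeyl := by
  rintro s ⟨i, m, -, rfl⟩
  exact P.affineReflection_mem i m

lemma mem_Omega_iff {x : P.Apartment} (hx : P.IsRegular x) {σ : P.IwahoriWeyl} :
    σ ∈ P.Omega (P.alcoveOf x) ↔ ∀ i m, ¬P.Separates i m x (σ • x) := by
  rw [Omega, MulAction.mem_stabilizer_iff, alcoveOf_smul]
  constructor
  · intro h
    exact not_separates_of_mem_alcoveOf (h ▸ self_mem_alcoveOf x)
  · intro h
    exact (alcoveOf_eq hx (hx.smul σ) h).symm

lemma smul_smul_add {w : P.IwahoriWeyl} {a b : ℝ} (hab : a + b = 1) (u v : P.Apartment) :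
    w • (a • u + b • v) = a • w • u + b • w • v := by
  refine P.apartment_ext fun i => ?_
  simp only [rootVal_smul_point, rootVal_add, rootVal_smul]
  linear_combination (-(P.toLinearMap (P.root i) w.left.toAdd : ℝ)) * hab

lemma toApartment_weyl_smul (g : P.Weyl) (ν : Y) :
    P.toApartment (g • ν) = (SemidirectProduct.inr g : P.IwahoriWeyl) • P.toApartment ν := by
  refine P.apartment_ext fun i => ?_
  rw [rootVal_smul_point, rootVal_toApartment, toLinearMap_weyl_smul]
  simp [rootPerm]

lemma smul_mem_orbitHull (g : P.Weyl) {μ : Y} {v : P.Apartment} (hv : v ∈ P.orbitHull μ) :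
    (SemidirectProduct.inr g : P.IwahoriWeyl) • v ∈ P.orbitHull μ := by
  have hconv : Convex ℝ {u : P.Apartment |
      (SemidirectProduct.inr g : P.IwahoriWeyl) • u ∈ P.orbitHull μ} := by
    intro u hu v hv a b ha hb hab
    simp only [Set.mem_ofPred_eq] at *
    rw [smul_smul_add hab]
    exact convex_convexHull ℝ _ hu hv ha hb hab
  refine convexHull_min ?_ hconv hv
  rintro _ ⟨lam, hlam, rfl⟩
  change (SemidirectProduct.inr g : P.IwahoriWeyl) • P.toApartment lam ∈ P.orbitHull μ
  rw [← toApartment_weyl_smul]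
  exact subset_convexHull ℝ _ ⟨_, MulAction.mem_orbit_of_mem_orbit g hlam, rfl⟩

lemma affineReflection_zero (i : ι) : P.affineReflection i 0 =
    SemidirectProduct.inr (RootPairing.weylGroup.ofIdx P.flip i) :=
  SemidirectProduct.ext (by simp) rfl

/-- Makes the class of `t_λ` modulo `W_a` constant on the orbit of `μ`. -/
lemma weyl_smul_sub_mem (g : P.Weyl) (ν : Y) : g • ν - ν ∈ P.corootSpan ℤ := by
  obtain ⟨g, hg⟩ := g
  induction hg using RootPairing.weylGroup.induction generalizing ν with
  | mem i =>
    have h := P.ofIdx_smul i ν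
    change RootPairing.weylGroup.ofIdx P.flip i • ν - ν ∈ _
    rw [h, sub_sub_cancel_left, ← neg_smul]
    exact Submodule.smul_mem _ _ (Submodule.subset_span ⟨i, rfl⟩)
  | one => simp
  | mul a b ha hb h1 h2 =>
    have h3 := add_mem (h1 ((⟨b, hb⟩ : P.Weyl) • ν)) (h2 ν)
    rwa [sub_add_sub_cancel, ← mul_smul] at h3

/-! ### The Bruhat order in terms of separation. -/

/-- The elementary steps of the Bruhat order, described by separation of alcoves. -/
def BruhatStep (P : RootDatum ι X Y) (x : P.Apartment) (a b : P.IwahoriWeyl) : Prop :=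
  ∃ (i : ι) (m : ℤ), b = P.affineReflection i m * a ∧ ¬P.Separates i m x (a • x)

section BruhatOrder

variable [Finite ι] [P.IsReduced]

/-- Steps multiply on the left by elements of `W_a`, so the whole chain has one component `σ = w *
b` in `Ω`. As `σ • x` and `x` lie in the same alcove, the separation test for `u * σ` is the one for
`u`, which compares lengths. -/
lemma bruhatLE_of_reflTransGen {x : P.Apartment} (hx : P.IsRegular x) {a b : P.IwahoriWeyl}
    (h : Relation.ReflTransGen (P.BruhatStep x) a b) : P.bruhatLE (P.alcoveOf x) a b := by
  obtain ⟨w, hw, hsep⟩ := exists_mem_closure_not_separates hx (hx.smul b)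
  have hwa : w ∈ P.affineWeyl := (Subgroup.closure_le _).2 (simpleReflections_subset _) hw
  rw [← mul_smul] at hsep
  refine ⟨w * b, (mem_Omega_iff hx).2 hsep, ?_⟩
  suffices ∃ u : P.affineWeyl, a = u * (w * b) ∧
      P.affineBruhatLE (P.alcoveOf x) u ⟨w⁻¹, inv_mem hwa⟩ by
    obtain ⟨u, h1, h2⟩ := this
    exact ⟨u, _, h1, by simp, h2⟩
  induction h using Relation.ReflTransGen.head_induction_on with
  | refl => exact ⟨⟨w⁻¹, inv_mem hwa⟩, by simp, .refl⟩
  | @head a c h _ ih =>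
    obtain ⟨u, h1, h2⟩ := ih
    obtain ⟨i, m, rfl, h3⟩ := h
    refine ⟨⟨P.affineReflection i m * u, mul_mem (P.affineReflection_mem i m) u.2⟩, ?_,
      .head ⟨i, m, by simp, ?_⟩ h2⟩
    · rw [mul_assoc, ← h1, affineReflection_mul_cancel]
    · have ha : a = P.affineReflection i m * u * (w * b) := by
        rw [mul_assoc, ← h1, affineReflection_mul_cancel]
      rw [ha, mul_smul] at h3
      set v := P.affineReflection i m * (u : P.IwahoriWeyl) with hv
      have h4 : ¬P.Separates i m (v • x) (v • (w * b) • x) := fun h5 =>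
        hsep _ _ ((separates_smul v (i, m) _ _).1 h5)
      have h5 : ¬P.Separates i m x (v • x) := by
        rw [separates_iff hx ((hx.smul _).smul _)] at h3
        rw [separates_iff (hx.smul _) ((hx.smul _).smul _)] at h4
        rw [separates_iff hx (hx.smul _)]
        tauto
      have h6 := lt_length_mul hx (mul_mem (P.affineReflection_mem i m) u.2) h5
      rwa [affineReflection_mul_cancel] at h6

/-- Admissible elements satisfy the convexity condition in the definition of permissibility. -/
lemma sub_mem_orbitHull_of_affineBruhatLE {x : P.Apartment} (hx : P.IsRegular x)
    {σ : P.IwahoriWeyl} (hσ : σ ∈ P.Omega (P.alcoveOf x)) {u v : P.affineWeyl} {μ : Y}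
    (h : P.affineBruhatLE (P.alcoveOf x) u v)
    (hv : ∀ a ∈ P.alcoveOf x, (v * σ : P.IwahoriWeyl) • a - a ∈ P.orbitHull μ) :
    ∀ a ∈ P.alcoveOf x, (u * σ : P.IwahoriWeyl) • a - a ∈ P.orbitHull μ := by
  induction h using Relation.ReflTransGen.head_induction_on with
  | refl => exact hv
  | @head u v h _ ih =>
    obtain ⟨i, m, h1, h2⟩ := h
    have hu : (u : P.IwahoriWeyl) = P.affineReflection i m * v := by
      rw [h1, affineReflection_mul_cancel]
    have hsep : P.Separates i m x ((v : P.IwahoriWeyl) • x) := by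
      by_contra hn
      have := lt_length_mul hx v.2 hn
      rw [← hu] at this
      omega
    intro a ha
    have hb := ih a ha
    have hσa : σ • a ∈ P.alcoveOf x := by
      have := Set.smul_mem_smul_set (a := σ) ha
      rwa [MulAction.mem_stabilizer_iff.1 hσ] at this
    have hva := smul_mem_alcoveOf (v : P.IwahoriWeyl) hσa
    rw [← mul_smul] at hva
    rw [hu, mul_assoc, mul_smul, affineReflection_smul]
    set z := ((v : P.IwahoriWeyl) * σ) • a with hz
    have hs := smul_mem_orbitHull (RootPairing.weylGroup.ofIdx P.flip i) hb
    rw [← affineReflection_zero, affineReflection_smul, Int.cast_zero, sub_zero, rootVal_sub] at hs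
    have hcases : (P.rootVal i a ≤ m ∧ m ≤ P.rootVal i z) ∨
        (P.rootVal i z ≤ m ∧ m ≤ P.rootVal i a) := by
      rcases hsep with ⟨h3, h4⟩ | ⟨h3, h4⟩
      · exact Or.inl ⟨(ha i m).1 h3, (hva i m).2 h4⟩
      · exact Or.inr ⟨(hva i m).1 h3, (ha i m).2 h4⟩
    by_cases h0 : P.rootVal i z - P.rootVal i a = 0
    · have : P.rootVal i z - m = 0 := by rcases hcases with h | h <;> linarith [h.1, h.2]
      rwa [this, zero_smul, sub_zero]
    -- With `b = z - a`, the new difference is `b - (β(z) - m)β^∨ = (1 - θ) b + θ s_β(b)`, and `0 ≤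
    -- θ ≤ 1` because the mirror weakly separates `a` from `z`.
    · set θ := (P.rootVal i z - m) / (P.rootVal i z - P.rootVal i a) with hθ
      have h5 : 0 ≤ θ ∧ 0 ≤ 1 - θ := by
        have : 1 - θ = (m - P.rootVal i a) / (P.rootVal i z - P.rootVal i a) := by
          rw [hθ]
          field_simp
          ring
        rw [this, hθ]
        rcases hcases with ⟨h3, h4⟩ | ⟨h3, h4⟩
        · exact ⟨div_nonneg (by linarith) (by linarith), div_nonneg (by linarith) (by linarith)⟩
        · exact ⟨div_nonneg_of_nonpos (by linarith) (by linarith),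
            div_nonneg_of_nonpos (by linarith) (by linarith)⟩
      have h6 := convex_convexHull ℝ _ hb hs h5.2 h5.1 (by ring)
      refine Set.mem_of_eq_of_mem ?_ h6
      refine P.apartment_ext fun j => ?_
      have h7 : θ * (P.rootVal i z - P.rootVal i a) = P.rootVal i z - m := by
        rw [hθ]
        field_simp
      simp only [rootVal_sub, rootVal_add, rootVal_smul]
      linear_combination (P.rootVal j (P.corootPt i)) * h7

end BruhatOrder

/-! ### Translations differing by a coroot. -/

lemma trans_sub_coroot (lam : Y) (i : ι) (q : ℤ) :
    P.trans (lam - P.coroot i) =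
      P.affineReflection i q * (P.affineReflection i (q + 1) * P.trans lam) := by
  refine SemidirectProduct.ext ?_ ?_
  · apply Multiplicative.toAdd.injective
    simp only [trans, SemidirectProduct.left_inl, SemidirectProduct.mul_left, toAdd_mul,
      weylAut_apply, affineReflection_left, affineReflection_right, toAdd_ofAdd, ofIdx_smul,
      map_add, map_sub, map_zsmul, P.toLinearMap_root_coroot, RootPairing.pairing_same, smul_eq_mul]
    module
  · refine P.weyl_ext fun ν => ?_
    simp only [trans, SemidirectProduct.right_inl, SemidirectProduct.mul_right, mul_smul,
      affineReflection_right, ofIdx_smul, map_sub, map_zsmul, P.toLinearMap_root_coroot,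
      RootPairing.pairing_same, smul_eq_mul, one_smul]
    module

/-- A translation element goes down in the Bruhat order when a coroot whose root is at least `2` on
the translation vector is subtracted. -/
lemma reflTransGen_trans_sub_coroot (x : P.Apartment) {lam : Y} {i : ι}
    (h : 2 ≤ P.toLinearMap (P.root i) lam) :
    Relation.ReflTransGen (P.BruhatStep x) (P.trans (lam - P.coroot i)) (P.trans lam) := by
  set n := P.toLinearMap (P.root i) lam with hn
  set p := ⌊P.rootVal i x⌋ with hp
  have hp1 : (p : ℝ) ≤ P.rootVal i x := Int.floor_le _
  have hp2 : P.rootVal i x < p + 1 := Int.lt_floor_add_one _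
  have hn2 : (2 : ℝ) ≤ n := by exact_mod_cast h
  -- The level `q` is free; this choice makes both steps ascend. First `β(x) < p + 1 ≤ q`, by `n ≥
  -- 2`, and `β(x) + n - 2 < q`. After the reflection, both values of `β` are at most `q + 1 = p +
  -- n`.
  have e1 := trans_sub_coroot (P := P) lam i (p + n - 1)
  rw [sub_add_cancel] at e1
  have v1 : P.rootVal i (P.trans (lam - P.coroot i) • x) = P.rootVal i x + n - 2 := by
    rw [trans_smul, rootVal_add, rootVal_toApartment, map_sub, P.toLinearMap_root_coroot,
      RootPairing.pairing_same, ← hn]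
    push_cast
    ring
  have v2 : P.rootVal i ((P.affineReflection i (p + n) * P.trans lam) • x) =
      2 * (p + n) - (P.rootVal i x + n) := by
    rw [mul_smul, rootVal_affineReflection_smul, trans_smul, rootVal_add, rootVal_toApartment, ← hn]
    push_cast
    ring
  refine .head (b := P.affineReflection i (p + n) * P.trans lam) ⟨i, p + n - 1, ?_, ?_⟩
    (.single ⟨i, p + n, ?_, ?_⟩)
  · rw [e1, affineReflection_mul_cancel]
  · unfold Separates
    rw [v1]
    push_cast
    rintro (⟨h1, h2⟩ | ⟨h1, h2⟩) <;> linarith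
  · rw [affineReflection_mul_cancel]
  · unfold Separates
    rw [v2]
    push_cast
    rintro (⟨h1, h2⟩ | ⟨h1, h2⟩) <;> linarith

lemma rootVal_inr_smul (g : P.Weyl) (i : ι) (v : P.Apartment) :
    P.rootVal i ((SemidirectProduct.inr g : P.IwahoriWeyl) • v) =
      P.rootVal (P.rootPerm (SemidirectProduct.inr g) i) v := by
  rw [rootVal_smul_point]
  simp

lemma inr_ofIdx_smul (i : ι) (v : P.Apartment) :
    (SemidirectProduct.inr (RootPairing.weylGroup.ofIdx P.flip i) : P.IwahoriWeyl) • v =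
      v - P.rootVal i v • P.corootPt i := by
  rw [← affineReflection_zero, affineReflection_smul, Int.cast_zero, sub_zero]

/-! ### The invariant form, dominance and the positive cone. -/

section Form

variable [Fintype ι]

variable (P) in
/-- The canonical invariant bilinear form on the apartment. -/
def apartmentForm : LinearMap.BilinForm ℝ P.Apartment :=
  ∑ i, (LinearMap.mul ℝ ℝ).compl₁₂ (P.rootForm i) (P.rootForm i)

lemma apartmentForm_apply (u v : P.Apartment) :
    P.apartmentForm u v = ∑ i, P.rootVal i u * P.rootVal i v := by
  simp [apartmentForm, LinearMap.sum_apply]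

lemma apartmentForm_sub_smul (u v w : P.Apartment) (c : ℝ) :
    P.apartmentForm u (v - c • w) = P.apartmentForm u v - c * P.apartmentForm u w := by
  rw [map_sub, map_smul, smul_eq_mul]

lemma apartmentForm_posDef : P.apartmentForm.toQuadraticMap.PosDef := by
  intro v hv
  rw [LinearMap.BilinMap.toQuadraticMap_apply, apartmentForm_apply]
  refine lt_of_le_of_ne (Finset.sum_nonneg fun i _ => mul_self_nonneg _) fun h => hv ?_
  have := (Finset.sum_eq_zero_iff_of_nonneg fun i _ => mul_self_nonneg (P.rootVal i v)).1 h.symm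
  exact P.apartment_ext fun i => mul_self_eq_zero.1 (this i (Finset.mem_univ i))

lemma apartmentForm_inr_smul (g : P.Weyl) (u v : P.Apartment) :
    P.apartmentForm ((SemidirectProduct.inr g : P.IwahoriWeyl) • u)
      ((SemidirectProduct.inr g : P.IwahoriWeyl) • v) = P.apartmentForm u v := by
  simp only [apartmentForm_apply, rootVal_inr_smul]
  exact Equiv.sum_comp (P.rootPerm (SemidirectProduct.inr g))
    fun i => P.rootVal i u * P.rootVal i v

/-- Invariance under the reflection gives this. It shows that pairing with a coroot under the form
has the sign of the root value. -/
lemma two_mul_apartmentForm_corootPt (v : P.Apartment) (i : ι) :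
    2 * P.apartmentForm v (P.corootPt i) =
      P.rootVal i v * P.apartmentForm (P.corootPt i) (P.corootPt i) := by
  have h := apartmentForm_inr_smul (RootPairing.weylGroup.ofIdx P.flip i) v (P.corootPt i)
  rw [inr_ofIdx_smul, inr_ofIdx_smul, rootVal_corootPt, RootPairing.pairing_same] at h
  simp only [map_sub, map_smul, LinearMap.sub_apply, LinearMap.smul_apply, smul_eq_mul] at h
  push_cast at h
  linarith

lemma apartmentForm_corootPt_self_pos (i : ι) :
    0 < P.apartmentForm (P.corootPt i) (P.corootPt i) := by
  refine apartmentForm_posDef _ fun h => ?_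
  have := P.rootVal_corootPt i i
  rw [h, RootPairing.pairing_same] at this
  norm_num at this

lemma apartmentForm_corootPt_pos_iff {v : P.Apartment} {i : ι} :
    0 < P.apartmentForm v (P.corootPt i) ↔ 0 < P.rootVal i v := by
  have h1 := two_mul_apartmentForm_corootPt v i
  have h2 := apartmentForm_corootPt_self_pos (P := P) i
  constructor
  · intro h
    by_contra! h3
    nlinarith
  · intro h
    nlinarith

lemma apartmentForm_corootPt_nonneg_iff {v : P.Apartment} {i : ι} :
    0 ≤ P.apartmentForm v (P.corootPt i) ↔ 0 ≤ P.rootVal i v := by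
  have h1 := two_mul_apartmentForm_corootPt v i
  have h2 := apartmentForm_corootPt_self_pos (P := P) i
  constructor
  · intro h
    by_contra! h3
    nlinarith
  · intro h
    nlinarith

/-- The form value depends on `g` only through a permutation of the finitely many roots, so a
maximum exists. -/
lemma exists_forall_apartmentForm_le (u v : P.Apartment) (S : Set P.Weyl) (hS : S.Nonempty) :
    ∃ g ∈ S, ∀ g' ∈ S, P.apartmentForm u ((SemidirectProduct.inr g' : P.IwahoriWeyl) • v) ≤
      P.apartmentForm u ((SemidirectProduct.inr g : P.IwahoriWeyl) • v) := by
  have hfin : ((fun g : P.Weyl =>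
      P.apartmentForm u ((SemidirectProduct.inr g : P.IwahoriWeyl) • v)) '' S).Finite := by
    refine (Set.finite_range fun e : ι ≃ ι => ∑ i, P.rootVal i u * P.rootVal (e i) v).subset ?_
    rintro _ ⟨g, -, rfl⟩
    exact ⟨P.rootPerm (SemidirectProduct.inr g), by
      simp only [apartmentForm_apply, rootVal_inr_smul]⟩
  obtain ⟨_, ⟨g, hg, rfl⟩, h⟩ := Set.exists_max_image _ id hfin (hS.image _)
  exact ⟨g, hg, fun g' hg' => h _ ⟨g', hg', rfl⟩⟩

end Form

/-- A cocharacter is dominant for the chamber of `h` if no root which is positive on `h` is negative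
on it. -/
def IsDominant (P : RootDatum ι X Y) (h : P.Apartment) (ν : Y) : Prop :=
  ∀ i, 0 < P.rootVal i h → 0 ≤ P.toLinearMap (P.root i) ν

/-- Choose `g` maximizing the form of `h` with `g • ν`: a positive root negative on `g • ν` would
give a reflection increasing it. -/
lemma exists_isDominant [Finite ι] (h : P.Apartment) (ν : Y) :
    ∃ g : P.Weyl, P.IsDominant h (g • ν) := by
  cases nonempty_fintype ι
  obtain ⟨g, -, hg⟩ := exists_forall_apartmentForm_le h (P.toApartment ν) Set.univ Set.univ_nonempty
  refine ⟨g, fun i hi => ?_⟩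
  by_contra! hneg
  have h1 := hg (RootPairing.weylGroup.ofIdx P.flip i * g) trivial
  rw [map_mul, mul_smul, inr_ofIdx_smul, ← toApartment_weyl_smul, rootVal_toApartment,
    apartmentForm_sub_smul] at h1
  have h2 := apartmentForm_corootPt_pos_iff.2 hi
  have h3 : (P.toLinearMap (P.root i) (g • ν) : ℝ) < 0 := by exact_mod_cast hneg
  nlinarith

lemma exists_root_eq_neg (i : ι) : ∃ j, P.root j = -P.root i :=
  ⟨P.reflectionPerm i i, by simp⟩

/-- The cone spanned by the coroots which are positive on the chamber of `h`. -/
def positiveCone (P : RootDatum ι X Y) (h : P.Apartment) : Submodule ℝ≥0 P.Apartment :=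
  Submodule.span ℝ≥0 (P.corootPt '' {i | 0 < P.rootVal i h})

lemma smul_corootPt_mem_positiveCone {h : P.Apartment} {i : ι} (hi : 0 < P.rootVal i h) {c : ℝ}
    (hc : 0 ≤ c) : c • P.corootPt i ∈ P.positiveCone h :=
  Submodule.smul_mem (P.positiveCone h) (⟨c, hc⟩ : ℝ≥0) (Submodule.subset_span ⟨i, hi, rfl⟩)

/-- The only element of the Weyl group which preserves positivity is the identity. -/
lemma weyl_eq_one [Finite ι] [P.IsReduced] {h : P.Apartment} (hh : ∀ i, P.rootVal i h ≠ 0)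
    {g : P.Weyl} (hg : ∀ i, 0 < P.rootVal i h →
      0 < P.rootVal i ((SemidirectProduct.inr g : P.IwahoriWeyl) • h)) : g = 1 := by
  cases nonempty_fintype ι
  -- Scaling by `M⁻¹` brings all root values into `(-1, 1)`, so only hyperplanes through the origin
  -- could separate `h` from its image; freeness of `W_a` on alcoves then applies.
  set M := 1 + ∑ i, |P.rootVal i h| with hM
  have hb : ∀ i, |P.rootVal i h| < M := fun i => by
    have := Finset.single_le_sum (f := fun i => |P.rootVal i h|) (fun i _ => abs_nonneg _)
      (Finset.mem_univ i)
    linarith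
  have hM0 : 0 < M := by positivity
  have hb1 : ∀ i, |P.rootVal i (M⁻¹ • h)| < 1 := fun i => by
    rw [rootVal_smul, abs_mul, abs_of_pos (inv_pos.2 hM0), inv_mul_lt_one₀ hM0]
    exact hb i
  have hne : ∀ i, P.rootVal i (M⁻¹ • h) ≠ 0 := fun i =>
    mul_ne_zero (inv_pos.2 hM0).ne' (hh i)
  have hreg : P.IsRegular (M⁻¹ • h) := fun i m hm => by
    have h1 := hb1 i
    rw [hm] at h1
    have h2 : |m| < 1 := by exact_mod_cast h1
    rw [Int.abs_lt_one_iff] at h2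
    exact hne i (by rw [hm, h2, Int.cast_zero])
  have hpos : ∀ i, 0 < P.rootVal i (M⁻¹ • h) →
      0 < P.rootVal i ((SemidirectProduct.inr g : P.IwahoriWeyl) • M⁻¹ • h) := fun i hi => by
    have h1 := hg i (pos_of_mul_pos_right hi (inv_pos.2 hM0).le)
    rw [rootVal_inr_smul] at h1 ⊢
    exact mul_pos (inv_pos.2 hM0) h1
  have hneg : ∀ i, P.rootVal i (M⁻¹ • h) < 0 →
      P.rootVal i ((SemidirectProduct.inr g : P.IwahoriWeyl) • M⁻¹ • h) < 0 := fun i hi => by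
    obtain ⟨j, hj⟩ := exists_root_eq_neg (P := P) i
    have h1 := hpos j
    rw [P.rootVal_of_root_eq_neg hj, P.rootVal_of_root_eq_neg hj] at h1
    linarith [h1 (by linarith)]
  have hmem : (SemidirectProduct.inr g : P.IwahoriWeyl) ∈ P.affineWeyl := by
    simp [affineWeyl]
  refine SemidirectProduct.inr_injective (φ := P.weylAut)
    ((eq_one_of_forall_not_separates hreg hmem fun i m => ?_).trans (map_one _).symm)
  have hi := abs_lt.1 (hb1 i)
  have hi' := abs_lt.1 (hb1 (P.rootPerm (SemidirectProduct.inr g) i))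
  rw [← rootVal_inr_smul] at hi'
  have hm : m ≤ -1 ∨ m = 0 ∨ 1 ≤ m := by omega
  rcases hm with hm | rfl | hm
  · have : (m : ℝ) ≤ -1 := by exact_mod_cast hm
    rintro (⟨h1, h2⟩ | ⟨h1, h2⟩) <;> linarith
  · rintro (⟨h1, h2⟩ | ⟨h1, h2⟩)
    · rw [Int.cast_zero] at h1 h2
      linarith [hneg i h1]
    · rw [Int.cast_zero] at h1 h2
      linarith [hpos i h2]
  · have : (1 : ℝ) ≤ m := by exact_mod_cast hm
    rintro (⟨h1, h2⟩ | ⟨h1, h2⟩) <;> linarith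

/-- A dominant cocharacter is the highest element of its orbit. -/
lemma sub_weyl_smul_mem_positiveCone [Finite ι] [P.IsReduced] {h : P.Apartment}
    (hh : ∀ i, P.rootVal i h ≠ 0) {ν : Y} (hν : P.IsDominant h ν) (g : P.Weyl) :
    P.toApartment ν - P.toApartment (g • ν) ∈ P.positiveCone h := by
  cases nonempty_fintype ι
  -- Among the `k` with `k • ν` above `g • ν`, take one bringing `k • h` closest to `h`. A positive
  -- root `β` negative on `k • h` has `⟨β, k • ν⟩ ≤ 0`, so `s_β k` stays in the set and increases
  -- the form.
  obtain ⟨k, hk, hmax⟩ := exists_forall_apartmentForm_le h h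
    {k : P.Weyl | P.toApartment (k • ν) - P.toApartment (g • ν) ∈ P.positiveCone h}
    ⟨g, by simp⟩
  suffices k = 1 by
    rw [this] at hk
    simpa using hk
  refine weyl_eq_one hh fun i hi => ?_
  by_contra! hneg
  have hlt : P.rootVal i ((SemidirectProduct.inr k : P.IwahoriWeyl) • h) < 0 := by
    refine lt_of_le_of_ne hneg ?_
    rw [rootVal_inr_smul]
    exact hh _
  have hle : P.toLinearMap (P.root i) (k • ν) ≤ 0 := by
    rw [toLinearMap_weyl_smul]
    rw [rootVal_inr_smul] at hlt
    obtain ⟨j, hj⟩ := exists_root_eq_neg (P := P) (P.rootPerm (SemidirectProduct.inr k) i)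
    have h1 := hν j (by rw [P.rootVal_of_root_eq_neg hj]; linarith)
    rw [hj, map_neg, LinearMap.neg_apply] at h1
    have h2 := neg_nonneg.1 h1
    exact h2
  have h1 := hmax (RootPairing.weylGroup.ofIdx P.flip i * k) (by
    rw [Set.mem_ofPred_eq, mul_smul, ofIdx_smul, map_sub, map_zsmul, sub_right_comm, sub_eq_add_neg]
    refine add_mem hk ?_
    have := smul_corootPt_mem_positiveCone hi (c := -(P.toLinearMap (P.root i) (k • ν) : ℝ)) (by
      rw [neg_nonneg]; exact_mod_cast hle)
    rwa [neg_smul, Int.cast_smul_eq_zsmul] at this)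
  rw [map_mul, mul_smul, inr_ofIdx_smul, apartmentForm_sub_smul] at h1
  have h2 := apartmentForm_corootPt_pos_iff.2 hi
  nlinarith

lemma pairingIn_int (P : RootDatum ι X Y) (i j : ι) : P.pairingIn ℤ i j = P.pairing i j := by
  simpa using RootPairing.algebraMap_pairingIn P ℤ i j

/-! ### Simple coroots and chains of dominant cocharacters. -/

section Simple

variable [Fintype ι]

/-- The additive functional on cocharacters defined by a point `h` of the apartment. -/
def coheight (P : RootDatum ι X Y) (h : P.Apartment) : Y →+ ℝ :=
  (P.apartmentForm h).toAddMonoidHom.comp P.toApartment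

lemma coheight_coroot_pos_iff {h : P.Apartment} {i : ι} :
    0 < P.coheight h (P.coroot i) ↔ 0 < P.rootVal i h :=
  apartmentForm_corootPt_pos_iff

/-- The indices of the simple coroots for the chamber of `h`. -/
def simpleIndices (P : RootDatum ι X Y) (h : P.Apartment) : Set ι :=
  IsAddIndecomposable.baseOf P.coroot (P.coheight h)

instance (h : P.Apartment) : Fintype (P.simpleIndices h) := Fintype.ofFinite _

instance (h : P.Apartment) : DecidableEq (P.simpleIndices h) := Classical.decEq _

lemma rootVal_pos_of_mem_simpleIndices {h : P.Apartment} {i : ι} (hi : i ∈ P.simpleIndices h) :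
    0 < P.rootVal i h :=
  coheight_coroot_pos_iff.1 hi.1

lemma exists_eq_sum_coroot {h : P.Apartment} {i : ι} (hi : 0 < P.rootVal i h) :
    ∃ c : P.simpleIndices h → ℕ, P.coroot i = ∑ k, c k • P.coroot k := by
  have h1 : P.coroot i ∈ AddSubmonoid.closure (P.coroot '' P.simpleIndices h) := by
    rw [simpleIndices, AddSubmonoid.closure_image_isAddIndecomposable_baseOf]
    exact AddSubmonoid.subset_closure ⟨i, coheight_coroot_pos_iff.2 hi, rfl⟩
  rw [Set.image_eq_range, ← Submodule.span_nat_eq_addSubmonoidClosure, Submodule.mem_toAddSubmonoid,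
    Submodule.mem_span_range_iff_exists_fun] at h1
  obtain ⟨c, hc⟩ := h1
  exact ⟨c, hc.symm⟩

lemma coheight_coroot_ne_zero {h : P.Apartment} (hh : ∀ i, P.rootVal i h ≠ 0) (i : ι) :
    P.coheight h (P.coroot i) ≠ 0 := by
  change P.apartmentForm h (P.corootPt i) ≠ 0
  intro h0
  have h1 := two_mul_apartmentForm_corootPt h i
  rw [h0, mul_zero] at h1
  exact mul_ne_zero (hh i) (apartmentForm_corootPt_self_pos i).ne' h1.symm

lemma pairing_nonpos_of_mem_simpleIndices {h : P.Apartment} (hh : ∀ i, P.rootVal i h ≠ 0) {i j : ι}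
    (hi : i ∈ P.simpleIndices h) (hj : j ∈ P.simpleIndices h) (hij : i ≠ j) :
    P.pairing i j ≤ 0 := by
  have h1 := P.flip.baseOf_pairwise_pairing_le_zero (P.coheight h) (coheight_coroot_ne_zero hh)
    hj hi hij.symm
  dsimp only at h1
  rwa [pairingIn_int P.flip, RootPairing.pairing_flip] at h1

/-- Vectors in an open half-space with pairwise non-positive inner products are independent. -/
lemma linearIndependent_corootPt {h : P.Apartment} (hh : ∀ i, P.rootVal i h ≠ 0) :
    LinearIndependent ℝ fun k : P.simpleIndices h => P.corootPt k := by
  refine LinearMap.BilinForm.linearIndependent_of_pairwise_le_zero P.apartmentForm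
    apartmentForm_posDef (P.apartmentForm h) _ (fun k => k.2.1) fun k l hkl => ?_
  have h1 := two_mul_apartmentForm_corootPt (P.corootPt k) (l : ι)
  have h2 := apartmentForm_corootPt_self_pos (P := P) l
  have h3 : (P.pairing l k : ℝ) ≤ 0 := by
    exact_mod_cast pairing_nonpos_of_mem_simpleIndices hh l.2 k.2 fun e => hkl (Subtype.ext e.symm)
  rw [rootVal_corootPt] at h1
  dsimp only
  nlinarith

lemma positiveCone_le (h : P.Apartment) :
    P.positiveCone h ≤ Submodule.span ℝ≥0 (Set.range fun k : P.simpleIndices h => P.corootPt k) := by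
  refine Submodule.span_le.2 ?_
  rintro _ ⟨i, hi, rfl⟩
  obtain ⟨c, hc⟩ := exists_eq_sum_coroot hi
  rw [corootPt, hc, map_sum]
  refine sum_mem fun k _ => ?_
  rw [map_nsmul]
  exact nsmul_mem (Submodule.subset_span (Set.mem_range_self k)) _

lemma exists_eq_sum_int_coroot {h : P.Apartment} (hh : ∀ i, P.rootVal i h ≠ 0) {ν : Y}
    (hν : ν ∈ P.corootSpan ℤ) :
    ∃ z : P.simpleIndices h → ℤ, ν = ∑ k, z k • P.coroot k := by
  suffices P.corootSpan ℤ ≤ Submodule.span ℤ (Set.range fun k : P.simpleIndices h => P.coroot k) by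
    obtain ⟨z, hz⟩ := (Submodule.mem_span_range_iff_exists_fun ℤ).1 (this hν)
    exact ⟨z, hz.symm⟩
  have key : ∀ i, 0 < P.rootVal i h →
      P.coroot i ∈ Submodule.span ℤ (Set.range fun k : P.simpleIndices h => P.coroot k) := by
    intro i hi
    obtain ⟨c, hc⟩ := exists_eq_sum_coroot hi
    rw [hc]
    exact sum_mem fun k _ => nsmul_mem (Submodule.subset_span (Set.mem_range_self k)) _
  refine Submodule.span_le.2 ?_
  rintro _ ⟨i, rfl⟩
  rcases lt_or_gt_of_ne (hh i) with hi | hi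
  · have h1 : P.root (P.reflectionPerm i i) = -P.root i := by simp
    have h2 : P.coroot (P.reflectionPerm i i) = -P.coroot i := by
      rw [RootPairing.coroot_reflectionPerm]
      simp
    have h3 := key (P.reflectionPerm i i) (by rw [P.rootVal_of_root_eq_neg h1]; linarith)
    rw [h2] at h3
    exact neg_mem_iff.1 h3
  · exact key i hi

/-- Integral elements of the positive cone are non-negative integral combinations of simple
coroots. -/
lemma exists_eq_sum_nat_coroot {h : P.Apartment} (hh : ∀ i, P.rootVal i h ≠ 0) {ν : Y}
    (hν : ν ∈ P.corootSpan ℤ) (hc : P.toApartment ν ∈ P.positiveCone h) :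
    ∃ n : P.simpleIndices h → ℕ, ν = ∑ k, n k • P.coroot k := by
  obtain ⟨z, hz⟩ := exists_eq_sum_int_coroot hh hν
  obtain ⟨c, hc⟩ := (Submodule.mem_span_range_iff_exists_fun ℝ≥0).1 (positiveCone_le h hc)
  -- The integral and the non-negative real expansions agree by independence, so the integers are
  -- non-negative.
  have h1 : ∑ k, (z k : ℝ) • P.corootPt k = ∑ k, (c k : ℝ) • P.corootPt k := by
    refine Eq.trans ?_ hc.symm
    rw [hz, map_sum]
    exact Finset.sum_congr rfl fun k _ => by rw [map_zsmul, Int.cast_smul_eq_zsmul]; rfl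
  have h2 : ∀ k, (z k : ℝ) = c k := by
    have h3 := linearIndependent_iff_injective_fintypeLinearCombination.1
      (linearIndependent_corootPt hh) (a₁ := fun k => (z k : ℝ)) (a₂ := fun k => (c k : ℝ)) h1
    exact congrFun h3
  refine ⟨fun k => (z k).toNat, ?_⟩
  rw [hz]
  refine Finset.sum_congr rfl fun k _ => ?_
  have h3 : 0 ≤ z k := by
    have : (0 : ℝ) ≤ z k := by rw [h2]; exact (c k).2
    exact_mod_cast this
  rw [← natCast_zsmul, Int.toNat_of_nonneg h3]

/-- Decomposing a positive coroot into simple ones says nothing direct about roots; the form, linear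
in the coroot, carries the sign across. -/
lemma isDominant_of_simple {h : P.Apartment} {ν : Y}
    (hν : ∀ k ∈ P.simpleIndices h, 0 ≤ P.toLinearMap (P.root k) ν) : P.IsDominant h ν := by
  intro i hi
  have h1 : 0 ≤ P.apartmentForm (P.toApartment ν) (P.corootPt i) := by
    obtain ⟨c, hc⟩ := exists_eq_sum_coroot hi
    rw [corootPt, hc, map_sum, map_sum]
    refine Finset.sum_nonneg fun k _ => ?_
    rw [map_nsmul, map_nsmul]
    refine nsmul_nonneg (apartmentForm_corootPt_nonneg_iff.2 ?_) _
    rw [rootVal_toApartment]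
    exact_mod_cast hν k k.2
  have h2 := apartmentForm_corootPt_nonneg_iff.1 h1
  rw [rootVal_toApartment] at h2
  exact_mod_cast h2

/-- A dominant cocharacter which is smaller than another one stays dominant and smaller after the
addition of a suitable positive coroot. -/
lemma exists_isDominant_add_coroot {h : P.Apartment} (hh : ∀ i, P.rootVal i h ≠ 0) {ν μ : Y}
    (hν : P.IsDominant h ν) (hμ : P.IsDominant h μ) {n : P.simpleIndices h → ℕ} (hn : n ≠ 0)
    (hsum : μ - ν = ∑ k, n k • P.coroot k) :
    ∃ (i : ι) (n' : P.simpleIndices h → ℕ), 0 < P.rootVal i h ∧ P.IsDominant h (ν + P.coroot i) ∧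
      μ - (ν + P.coroot i) = ∑ k, n' k • P.coroot k ∧ ∑ k, n' k < ∑ k, n k := by
  -- Heights of the positive coroots bounded by `n` coefficientwise; the coroot to be added is one
  -- of maximal height.
  let S : Set ℕ := {s | ∃ (i : ι) (c : P.simpleIndices h → ℕ), 0 < P.rootVal i h ∧
    P.coroot i = ∑ k, c k • P.coroot k ∧ c ≤ n ∧ ∑ k, c k = s}
  have hS : S.Nonempty := by
    obtain ⟨k, hk⟩ := Function.ne_iff.1 hn
    refine ⟨_, k, Pi.single k 1, rootVal_pos_of_mem_simpleIndices k.2, ?_, ?_, rfl⟩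
    · simp [Pi.single_apply]
    · intro l
      by_cases hl : l = k
      · subst hl
        rw [Pi.single_eq_same]
        exact Nat.one_le_iff_ne_zero.2 hk
      · simp [hl]
  have hbdd : BddAbove S := ⟨∑ k, n k, by
    rintro _ ⟨i, c, -, -, hc, rfl⟩
    exact Finset.sum_le_sum fun k _ => hc k⟩
  obtain ⟨i, c, hi, hc, hcn, hs⟩ := Nat.sSup_mem hS hbdd
  have hsum' : μ - (ν + P.coroot i) = ∑ k, (n k - c k) • P.coroot k := by
    rw [← sub_sub, hsum, hc, ← Finset.sum_sub_distrib]
    refine Finset.sum_congr rfl fun k _ => ?_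
    rw [sub_eq_iff_eq_add, ← add_smul, Nat.sub_add_cancel (hcn k)]
  refine ⟨i, fun k => n k - c k, hi, isDominant_of_simple fun k hk => ?_, hsum', ?_⟩
  · by_contra! hneg
    have hνk := hν k (rootVal_pos_of_mem_simpleIndices hk)
    rw [map_add, P.toLinearMap_root_coroot] at hneg
    have hki : P.pairing k i < 0 := by linarith
    have hne : P.coroot i ≠ -P.coroot k := fun e => by
      have h1 := coheight_coroot_pos_iff.2 hi
      have h2 := coheight_coroot_pos_iff.2 (rootVal_pos_of_mem_simpleIndices hk)
      rw [e, map_neg] at h1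
      linarith
    obtain ⟨j, hj⟩ := P.flip.root_add_root_mem_of_pairingIn_neg (i := i) (j := k)
      (by rwa [pairingIn_int P.flip, RootPairing.pairing_flip]) hne
    replace hj : P.coroot j = P.coroot i + P.coroot k := hj
    have hjpos : 0 < P.rootVal j h := by
      have h1 := coheight_coroot_pos_iff.2 hi
      have h2 := coheight_coroot_pos_iff.2 (rootVal_pos_of_mem_simpleIndices hk)
      rw [← coheight_coroot_pos_iff, hj, map_add]
      linarith
    let k' : P.simpleIndices h := ⟨k, hk⟩
    -- If dominance fails at `k`, adding the simple coroot at `k` gives another coroot. With room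
    -- left in `n k` this contradicts maximality. Otherwise that simple coroot is absent from the
    -- remaining difference, whose pairing with `β_k` is thus `≤ 0`, contradicting the dominance of
    -- `μ`.
    rcases (hcn k').lt_or_eq with hlt | heq
    · have hmem : ∑ l, (c + Pi.single k' 1 : P.simpleIndices h → ℕ) l ∈ S := by
        refine ⟨j, c + Pi.single k' 1, hjpos, ?_, ?_, rfl⟩
        · rw [hj, hc]
          simp [add_smul, Finset.sum_add_distrib, Pi.single_apply, k']
        · intro l
          by_cases hl : l = k'
          · subst hl
            simpa using hlt
          · simpa [hl] using hcn l
      have h1 := le_csSup hbdd hmem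
      rw [← hs] at h1
      simp [Finset.sum_add_distrib] at h1
    · have h1 : P.toLinearMap (P.root k) (μ - (ν + P.coroot i)) ≤ 0 := by
        rw [hsum', map_sum]
        refine Finset.sum_nonpos fun l _ => ?_
        by_cases hl : l = k'
        · subst hl
          simp [heq]
        · rw [map_nsmul, P.toLinearMap_root_coroot]
          refine smul_nonpos_of_nonneg_of_nonpos (Nat.zero_le _)
            (pairing_nonpos_of_mem_simpleIndices hh hk l.2 fun e => hl (Subtype.ext e.symm))
      rw [map_sub, map_add, P.toLinearMap_root_coroot] at h1
      have h2 := hμ k (rootVal_pos_of_mem_simpleIndices hk)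
      linarith
  · have hc0 : c ≠ 0 := by
      rintro rfl
      refine P.ne_zero' i ?_
      simpa using hc
    obtain ⟨k, hk⟩ := Function.ne_iff.1 hc0
    refine Finset.sum_lt_sum (fun l _ => Nat.sub_le _ _) ⟨k, Finset.mem_univ k, ?_⟩
    exact Nat.sub_lt_of_pos_le (Nat.pos_of_ne_zero hk) (hcn k)

/-- The twist by `g` costs nothing: a link needs only a pairing at least 2 (2 from the added coroot,
the rest from dominance), and this is invariant under `W`. -/
lemma reflTransGen_trans_of_isDominant (x : P.Apartment) {h : P.Apartment}
    (hh : ∀ i, P.rootVal i h ≠ 0) {ν μ : Y}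
    (hν : P.IsDominant h ν) (hμ : P.IsDominant h μ) {n : P.simpleIndices h → ℕ}
    (hsum : μ - ν = ∑ k, n k • P.coroot k) (g : P.Weyl) :
    Relation.ReflTransGen (P.BruhatStep x) (P.trans (g • ν)) (P.trans (g • μ)) := by
  induction hN : ∑ k, n k using Nat.strong_induction_on generalizing ν n with
  | _ N ih =>
    by_cases hn : n = 0
    · have : μ - ν = 0 := by simpa [hn] using hsum
      rw [sub_eq_zero.1 this]
    · obtain ⟨i, n', hi, hdom, hsum', hlt⟩ := exists_isDominant_add_coroot hh hν hμ hn hsum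
      refine .trans ?_ (ih _ (hN ▸ hlt) hdom hsum' rfl)
      have h1 : g • ν = g • (ν + P.coroot i) - P.coroot ((g : P.flip.Aut).toHom.indexEquiv i) := by
        rw [smul_add, weyl_smul_coroot, add_sub_cancel_right]
      rw [h1]
      refine reflTransGen_trans_sub_coroot x ?_
      rw [toLinearMap_weyl_smul, Equiv.symm_apply_apply, map_add, P.toLinearMap_root_coroot,
        RootPairing.pairing_same]
      linarith [hν i hi]

end Simple

/-! ### From the hull to the admissible set, and the theorem. -/

lemma trans_mem_Adm [Finite ι] [P.IsReduced] {x : P.Apartment} (hx : P.IsRegular x) {ν μ : Y}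
    (hmod : μ - ν ∈ P.corootSpan ℤ) (hν : P.toApartment ν ∈ P.orbitHull μ) :
    P.trans ν ∈ P.Adm (P.alcoveOf x) μ := by
  cases nonempty_fintype ι
  have hh : ∀ i, P.rootVal i x ≠ 0 := fun i => by simpa using hx i 0
  obtain ⟨g, hg⟩ := exists_isDominant x ν
  obtain ⟨k, hk⟩ := exists_isDominant x μ
  have hcone : P.toApartment (k • μ - g • ν) ∈ P.positiveCone x := by
    -- The set on the right is convex and contains the orbit of the dominant `k • μ`.
    have hsub : P.orbitHull μ ⊆ {v | P.toApartment (k • μ) - v ∈ P.positiveCone x} := by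
      refine convexHull_min ?_ ?_
      · rintro _ ⟨_, ⟨a, rfl⟩, rfl⟩
        have := sub_weyl_smul_mem_positiveCone hh hk (a * k⁻¹)
        rwa [smul_smul, inv_mul_cancel_right] at this
      · intro u hu v hv a b ha hb hab
        have := add_mem (Submodule.smul_mem (P.positiveCone x) (⟨a, ha⟩ : ℝ≥0) hu)
          (Submodule.smul_mem (P.positiveCone x) (⟨b, hb⟩ : ℝ≥0) hv)
        have heq : P.toApartment (k • μ) - (a • u + b • v) =
            a • (P.toApartment (k • μ) - u) + b • (P.toApartment (k • μ) - v) := by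
          rw [← eq_sub_iff_add_eq] at hab
          subst hab
          module
        rw [Set.mem_ofPred_eq, heq]
        exact this
    have := hsub (smul_mem_orbitHull g hν)
    rwa [← toApartment_weyl_smul, Set.mem_ofPred_eq, ← map_sub] at this
  have hmod' : k • μ - g • ν ∈ P.corootSpan ℤ := by
    have := sub_mem (add_mem (weyl_smul_sub_mem k μ) hmod) (weyl_smul_sub_mem g ν)
    rwa [sub_add_sub_cancel, sub_sub_sub_cancel_right] at this
  obtain ⟨n, hn⟩ := exists_eq_sum_nat_coroot hh hmod' hcone
  have hchain := reflTransGen_trans_of_isDominant x hh hg hk hn g⁻¹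
  rw [inv_smul_smul] at hchain
  exact ⟨g⁻¹ • k • μ, by rw [smul_smul]; exact MulAction.mem_orbit _ _,
    bruhatLE_of_reflTransGen hx hchain⟩

lemma mk_eq_mk_trans_iff {w : P.IwahoriWeyl} {ν : Y} :
    (QuotientGroup.mk w : P.IwahoriWeyl ⧸ P.affineWeyl) = QuotientGroup.mk (P.trans ν) ↔
      w.left.toAdd - ν ∈ P.corootSpan ℤ := by
  rw [eq_comm, QuotientGroup.eq]
  change ((P.trans ν)⁻¹ * w).left.toAdd ∈ P.corootSpan ℤ ↔ _
  simp [trans, neg_add_eq_sub]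

end RootDatum

end

/-- For a split group with root datum `P`, cocharacter class `W μ` and any alcove `A`, the admissible
and the permissible set contain the same translation elements. -/
theorem proposition3p5 {ι X Y : Type*} [Finite ι] [AddCommGroup X] [AddCommGroup Y]
    [Module.Finite ℤ X] [Module.Finite ℤ Y] (P : RootDatum ι X Y) [P.IsReduced]
    (A : Set P.Apartment) (hA : P.IsAlcove A) (μ : Y) :
    Set.range P.trans ∩ P.Adm A μ = Set.range P.trans ∩ P.Perm A μ := by
  obtain ⟨x, hx, rfl⟩ := hA
  change Set.range P.trans ∩ P.Adm (P.alcoveOf x) μ = Set.range P.trans ∩ P.Perm (P.alcoveOf x) μ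
  ext w
  refine and_congr_right ?_
  rintro ⟨ν, rfl⟩
  constructor
  · rintro ⟨_, ⟨g, rfl⟩, σ, hσ, u, v, hu, hv, huv⟩
    constructor
    · rintro _ ⟨g', rfl⟩
      rw [RootDatum.mk_eq_mk_trans_iff]
      have h1 : P.trans ν * (P.trans (g • μ))⁻¹ ∈ P.affineWeyl := by
        rw [hu, hv, mul_inv_rev, mul_assoc, mul_inv_cancel_left]
        exact mul_mem u.2 (inv_mem v.2)
      have h2 : ν - g • μ ∈ P.corootSpan ℤ := by
        have : P.trans ν * (P.trans (g • μ))⁻¹ = P.trans (ν - g • μ) := by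
          rw [RootDatum.trans, RootDatum.trans, RootDatum.trans, ← map_inv, ← map_mul, ← ofAdd_neg,
            ← ofAdd_add, sub_eq_add_neg]
        rw [this] at h1
        exact h1
      have h3 := sub_mem (add_mem h2 (RootDatum.weyl_smul_sub_mem g μ))
        (RootDatum.weyl_smul_sub_mem g' μ)
      rw [sub_add_sub_cancel, sub_sub_sub_cancel_right] at h3
      exact h3
    · rw [hu]
      refine RootDatum.sub_mem_orbitHull_of_affineBruhatLE hx hσ huv fun a _ => ?_
      rw [← hv, RootDatum.trans_smul, add_sub_cancel_left]
      exact subset_convexHull ℝ _ ⟨_, ⟨g, rfl⟩, rfl⟩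
  · rintro ⟨h1, h2⟩
    refine RootDatum.trans_mem_Adm hx ?_ ?_
    · have := RootDatum.mk_eq_mk_trans_iff.1 (h1 μ (MulAction.mem_orbit_self μ))
      rw [← neg_sub]
      exact neg_mem this
    -- A translation moves every point by `ν_ad`, so testing one point suffices.
    · have := h2 x (RootDatum.self_mem_alcoveOf x)
      rwa [RootDatum.trans_smul, add_sub_cancel_left] at this
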